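/- For $k\in\mathbb N$ let $\mathcal P_2(\mathbb R^k)$ be the set of Borel probability measures $\mu$ on $\mathbb R^k$ with $\int|x|^2\,\mu(dx)<\infty$. For probability measures $\mu,\nu$ on $\mathbb R^m$ let $$W_2(\mu,\nu)=\Big(\inf_{\pi\in\Pi(\mu,\nu)}\int\tfrac12|x-y|^2\,\pi(dx,dy)\Big)^{1/2},$$ where $\Pi(\mu,\nu)$ is the set of probability measures on $\mathbb R^m\times\mathbb R^m$ with first marginal $\mu$ and second marginal $\nu$. For $\theta$ in the unit sphere $\mathcal S^{k-1}$ of $\mathbb R^k$ let $\mu_\theta$ be the image of $\mu$ under $x\mapsto x^\top\theta$, and let $$SW_2(\mu,\nu)=\Big(\int_{\mathcal S^{k-1}}W_2(\mu_\theta,\nu_\theta)^2\,d\theta\Big)^{1/2},$$ where $d\theta$ is the uniform probability measure on $\mathcal S^{k-1}$. For $\sigma\ge0$ let $\mathcal N_\sigma$ be the normal distribution on $\mathbb R^k$ with mean $0$ and covariance matrix $\sigma^2I_k$ (the Dirac mass at $0$ if $\sigma=0$), and let $$SW_2^\sigma(\mu,\nu)=SW_2(\mu*\mathcal N_\sigma,\nu*\mathcal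 N_\sigma).$$ Then, for every $\sigma\ge0$, both $W_2$ and $SW_2^\sigma$ are (finite) metrics on $\mathcal P_2(\mathbb R^k)$, the metric space $(\mathcal P_2(\mathbb R^k),SW_2^\sigma)$ is complete, and $SW_2^\sigma$ induces on $\mathcal P_2(\mathbb R^k)$ the same topology as $W_2$. -/

import Mathlib

open MeasureTheory ProbabilityTheory
open scoped ENNReal

noncomputable section

/-- The set `Π(μ, ν)` of couplings of `μ` and `ν`: the probability measures on the product
with first marginal `μ` and second marginal `ν`. -/
def couplings {E : Type*} [MeasurableSpace E] (μ ν : Measure E) : Set (Measure (E × E)) :=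
  {π | IsProbabilityMeasure π ∧ π.map Prod.fst = μ ∧ π.map Prod.snd = ν}

/-- The 2-Wasserstein distance, with the cost `|x - y|² / 2`. It takes values in `[0, ∞]`, so
that no integrability has to be known for the definition to have its intended meaning. -/
def W2 {E : Type*} [NormedAddCommGroup E] [MeasurableSpace E] (μ ν : Measure E) : ℝ≥0∞ :=
  (⨅ π ∈ couplings μ ν, ∫⁻ z, ENNReal.ofReal (1 / 2 * ‖z.1 - z.2‖ ^ 2) ∂π) ^ (1 / 2 : ℝ)

/-- The push-forward `μ_θ` of `μ` under the projection `x ↦ xᵀ θ`. -/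
def proj {k : ℕ} (μ : Measure (EuclideanSpace ℝ (Fin k))) (θ : EuclideanSpace ℝ (Fin k)) :
    Measure ℝ :=
  μ.map (fun x => inner ℝ x θ)

/-- The uniform probability measure on the unit sphere of `ℝᵏ`, that is, the normalized surface
measure. -/
def sphereMeasure (k : ℕ) : Measure (Metric.sphere (0 : EuclideanSpace ℝ (Fin k)) 1) :=
  ((volume : Measure (EuclideanSpace ℝ (Fin k))).toSphere Set.univ)⁻¹ •
    (volume : Measure (EuclideanSpace ℝ (Fin k))).toSphere

/-- The sliced Wasserstein distance. -/
def SW2 {k : ℕ} (μ ν : Measure (EuclideanSpace ℝ (Fin k))) : ℝ≥0∞ :=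
  (∫⁻ θ, W2 (proj μ θ) (proj ν θ) ^ 2 ∂sphereMeasure k) ^ (1 / 2 : ℝ)

/-- The centred normal distribution on `ℝᵏ` with covariance matrix `σ² I`
(the Dirac mass at the origin if `σ = 0`). -/
def gaussianN (k : ℕ) (σ : ℝ) : Measure (EuclideanSpace ℝ (Fin k)) :=
  multivariateGaussian 0 (σ ^ 2 • (1 : Matrix (Fin k) (Fin k) ℝ))

/-- The Gaussian-regularized sliced Wasserstein distance. -/
def SW2reg {k : ℕ} (σ : ℝ) (μ ν : Measure (EuclideanSpace ℝ (Fin k))) : ℝ≥0∞ :=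
  SW2 (μ.conv (gaussianN k σ)) (ν.conv (gaussianN k σ))

/-- The set `P₂(ℝᵏ)` of Borel probability measures on `ℝᵏ` with finite second moment. -/
structure P2 (k : ℕ) where
  /-- The underlying measure. -/
  toMeasure : Measure (EuclideanSpace ℝ (Fin k))
  isProb : IsProbabilityMeasure toMeasure
  finite_moment : ∫⁻ x, ENNReal.ofReal (‖x‖ ^ 2) ∂toMeasure < ∞

end

noncomputable section

open Filter Topology
open scoped NNReal

lemma ENNReal.le_of_sq_le_sq {a b : ℝ≥0∞} (h : a ^ 2 ≤ b ^ 2) : a ≤ b :=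
  le_of_not_gt fun hlt => (not_lt.2 h) (ENNReal.pow_lt_pow_left (by norm_num) hlt)

section Wasserstein

variable {Ω E F : Type*} [MeasurableSpace Ω] [NormedAddCommGroup E] [NormedAddCommGroup F]

/-- The factor `√(1/2)` relating the transport cost to the `L²` norm. -/
def costFactor : ℝ≥0∞ := (1 / 2 : ℝ≥0∞) ^ (1 / 2 : ℝ)

lemma costFactor_ne_top : costFactor ≠ ∞ :=
  ENNReal.rpow_ne_top_of_nonneg (by norm_num) (by simp)

lemma costFactor_ne_zero : costFactor ≠ 0 := by
  simp [costFactor, ENNReal.rpow_eq_zero_iff]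

lemma costFactor_le_one : costFactor ≤ 1 :=
  ENNReal.rpow_le_one (by simp) (by norm_num)

lemma costFactor_sq : costFactor ^ 2 = 1 / 2 := by
  rw [costFactor, ← ENNReal.rpow_natCast, ← ENNReal.rpow_mul]
  norm_num

lemma ofReal_half_mul_sq_norm (x : E) :
    ENNReal.ofReal (1 / 2 * ‖x‖ ^ 2) = 1 / 2 * ‖x‖ₑ ^ 2 := by
  rw [ENNReal.ofReal_mul (by norm_num), ENNReal.ofReal_pow (norm_nonneg _), ofReal_norm]
  congr 1
  rw [ENNReal.ofReal_div_of_pos (by norm_num)]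
  simp

lemma eLpNorm_two_sq (f : Ω → E) (P : Measure Ω) :
    eLpNorm f 2 P ^ 2 = ∫⁻ ω, ‖f ω‖ₑ ^ 2 ∂P := by
  rw [eLpNorm_eq_lintegral_rpow_enorm_toReal (by norm_num) (by norm_num),
    ← ENNReal.rpow_natCast, ← ENNReal.rpow_mul]
  simp

lemma sqrt_cost (f : Ω → E) (P : Measure Ω) :
    (∫⁻ ω, ENNReal.ofReal (1 / 2 * ‖f ω‖ ^ 2) ∂P) ^ (1 / 2 : ℝ) =
      costFactor * eLpNorm f 2 P := by
  simp_rw [ofReal_half_mul_sq_norm]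
  rw [lintegral_const_mul' _ _ (by simp), ENNReal.mul_rpow_of_nonneg _ _ (by norm_num),
    ← eLpNorm_two_sq, ← ENNReal.rpow_natCast, ← ENNReal.rpow_mul]
  simp [costFactor]

variable [MeasurableSpace E] [MeasurableSpace F]

lemma W2_eq_iInf (μ ν : Measure E) :
    W2 μ ν = ⨅ π ∈ couplings μ ν, costFactor * eLpNorm (fun z : E × E => z.1 - z.2) 2 π := by
  simp_rw [← sqrt_cost, W2]
  change ENNReal.orderIsoRpow (1 / 2) (by norm_num) _ = _
  simp only [OrderIso.map_iInf, ENNReal.orderIsoRpow_apply]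

lemma W2_le_of_mem {μ ν : Measure E} {π : Measure (E × E)} (h : π ∈ couplings μ ν) :
    W2 μ ν ≤ costFactor * eLpNorm (fun z : E × E => z.1 - z.2) 2 π := by
  rw [W2_eq_iInf]
  exact iInf₂_le π h

lemma exists_coupling_lt {μ ν : Measure E} {r : ℝ≥0∞} (h : W2 μ ν < r) :
    ∃ π ∈ couplings μ ν, costFactor * eLpNorm (fun z : E × E => z.1 - z.2) 2 π < r := by
  rw [W2_eq_iInf] at h
  simpa only [iInf_lt_iff, exists_prop] using h

variable [BorelSpace E]

lemma W2_map_le [SecondCountableTopology E] {P : Measure Ω} [IsProbabilityMeasure P] {X Y : Ω → E}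
    (hX : Measurable X) (hY : Measurable Y) :
    W2 (P.map X) (P.map Y) ≤ costFactor * eLpNorm (fun ω => X ω - Y ω) 2 P := by
  have hm : Measurable fun ω => (X ω, Y ω) := hX.prodMk hY
  refine (W2_le_of_mem (π := P.map fun ω => (X ω, Y ω)) ⟨?_, ?_, ?_⟩).trans ?_
  · exact Measure.isProbabilityMeasure_map hm.aemeasurable
  · rw [Measure.map_map measurable_fst hm]; rfl
  · rw [Measure.map_map measurable_snd hm]; rfl
  · rw [eLpNorm_map_measure (by fun_prop) hm.aemeasurable]
    rfl

lemma W2_map_le_W2 [BorelSpace F] [SecondCountableTopology F] {f : E → F}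
    (hf : LipschitzWith 1 f) (μ ν : Measure E) :
    W2 (μ.map f) (ν.map f) ≤ W2 μ ν := by
  have hfm : Measurable f := hf.continuous.measurable
  rw [W2_eq_iInf μ ν]
  refine le_iInf₂ fun π hπ => ?_
  have := hπ.1
  have h := W2_map_le (P := π) (hfm.comp measurable_fst) (hfm.comp measurable_snd)
  rw [← Measure.map_map hfm measurable_fst, ← Measure.map_map hfm measurable_snd,
    hπ.2.1, hπ.2.2] at h
  refine h.trans ?_
  gcongr
  refine eLpNorm_mono fun z => ?_
  simpa [dist_eq_norm] using hf.dist_le_mul z.1 z.2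

variable [SecondCountableTopology E]

lemma W2_self (μ : Measure E) [IsProbabilityMeasure μ] : W2 μ μ = 0 := by
  have := W2_map_le (P := μ) measurable_id measurable_id
  simpa using this

lemma W2_comm_le (μ ν : Measure E) : W2 ν μ ≤ W2 μ ν := by
  rw [W2_eq_iInf μ ν]
  refine le_iInf₂ fun π hπ => ?_
  have := hπ.1
  have h := W2_map_le (P := π) measurable_snd measurable_fst
  rw [hπ.2.1, hπ.2.2] at h
  refine h.trans_eq ?_
  rw [← eLpNorm_neg]
  congr 2
  ext z
  simp

lemma W2_comm (μ ν : Measure E) : W2 μ ν = W2 ν μ :=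
  le_antisymm (W2_comm_le _ _) (W2_comm_le _ _)

lemma W2_triangle [CompleteSpace E] (μ ν ρ : Measure E) :
    W2 μ ρ ≤ W2 μ ν + W2 ν ρ := by
  refine ENNReal.le_of_forall_pos_le_add fun ε hε hfin => ?_
  have hε2 : (ε / 2 : ℝ≥0∞) ≠ 0 := by simpa using hε.ne'
  obtain ⟨h₁, h₂⟩ := ENNReal.add_lt_top.1 hfin
  obtain ⟨π, hπ, hπlt⟩ := exists_coupling_lt (ENNReal.lt_add_right h₁.ne hε2)
  obtain ⟨τ, hτ, hτlt⟩ := exists_coupling_lt (ENNReal.lt_add_right h₂.ne hε2)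
  have := hπ.1
  have := hτ.1
  let κ := (π.map Prod.swap).condKernel
  let η := τ.condKernel
  have : IsProbabilityMeasure (π.map Prod.swap) :=
    Measure.isProbabilityMeasure_map measurable_swap.aemeasurable
  have : IsProbabilityMeasure ν :=
    hτ.2.1 ▸ Measure.isProbabilityMeasure_map measurable_fst.aemeasurable
  have hκ : ν ⊗ₘ κ = π.map Prod.swap := by
    have := (π.map Prod.swap).disintegrate κ
    rwa [Measure.fst, Measure.map_map measurable_fst measurable_swap,
      show Prod.fst ∘ Prod.swap = (Prod.snd : E × E → E) from rfl, hπ.2.2] at this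
  have hη : ν ⊗ₘ η = τ := by
    have := τ.disintegrate η
    rwa [Measure.fst, hτ.2.1] at this
  let P : Measure (E × E × E) := ν ⊗ₘ (κ ×ₖ η)
  have hPκ : P.map (fun z => (z.1, z.2.1)) = π.map Prod.swap := by
    have h := Measure.compProd_map (μ := ν) (κ := κ ×ₖ η) (f := Prod.fst) measurable_fst
    rw [← Kernel.fst_eq, Kernel.fst_prod, hκ] at h
    exact h.symm
  have hPη : P.map (fun z => (z.1, z.2.2)) = τ := by
    have h := Measure.compProd_map (μ := ν) (κ := κ ×ₖ η) (f := Prod.snd) measurable_snd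
    rw [← Kernel.snd_eq, Kernel.snd_prod, hη] at h
    exact h.symm
  have hX : P.map (fun z => z.2.1) = μ := by
    rw [← hπ.2.1, show (fun z : E × E × E => z.2.1) = Prod.snd ∘ fun z => (z.1, z.2.1) from rfl,
      ← Measure.map_map measurable_snd (by fun_prop), hPκ,
      Measure.map_map measurable_snd measurable_swap]
    rfl
  have hZ : P.map (fun z => z.2.2) = ρ := by
    rw [← hτ.2.2, show (fun z : E × E × E => z.2.2) = Prod.snd ∘ fun z => (z.1, z.2.2) from rfl,
      ← Measure.map_map measurable_snd (by fun_prop), hPη]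
  have hXY : eLpNorm (fun z : E × E × E => z.2.1 - z.1) 2 P =
      eLpNorm (fun z : E × E => z.1 - z.2) 2 π := by
    have h : P.map (fun z => (z.2.1, z.1)) = π := by
      rw [show (fun z : E × E × E => (z.2.1, z.1)) = Prod.swap ∘ fun z => (z.1, z.2.1) from rfl,
        ← Measure.map_map measurable_swap (by fun_prop), hPκ,
        Measure.map_map measurable_swap measurable_swap]
      simp
    rw [← h, eLpNorm_map_measure (by fun_prop) (by fun_prop)]
    rfl
  have hYZ : eLpNorm (fun z : E × E × E => z.1 - z.2.2) 2 P =
      eLpNorm (fun z : E × E => z.1 - z.2) 2 τ := by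
    rw [← hPη, eLpNorm_map_measure (by fun_prop) (by fun_prop)]
    rfl
  calc W2 μ ρ ≤ costFactor * eLpNorm (fun z : E × E × E => z.2.1 - z.2.2) 2 P := by
        rw [← hX, ← hZ]
        exact W2_map_le (by fun_prop) (by fun_prop)
    _ ≤ costFactor * (eLpNorm (fun z : E × E × E => z.2.1 - z.1) 2 P +
          eLpNorm (fun z : E × E × E => z.1 - z.2.2) 2 P) := by
        gcongr
        refine le_trans (le_of_eq ?_) (eLpNorm_add_le (by fun_prop) (by fun_prop) (by norm_num))
        congr 1
        ext z
        simp
    _ = costFactor * eLpNorm (fun z : E × E => z.1 - z.2) 2 π +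
          costFactor * eLpNorm (fun z : E × E => z.1 - z.2) 2 τ := by rw [mul_add, hXY, hYZ]
    _ ≤ (W2 μ ν + ε / 2) + (W2 ν ρ + ε / 2) := by gcongr
    _ = W2 μ ν + W2 ν ρ + ε := by rw [add_add_add_comm, ENNReal.add_halves]

lemma W2_conv_le (μ ν ρ : Measure E) [IsProbabilityMeasure ρ] :
    W2 (μ.conv ρ) (ν.conv ρ) ≤ W2 μ ν := by
  rw [W2_eq_iInf μ ν]
  refine le_iInf₂ fun π hπ => ?_
  have := hπ.1
  have h₁ : (π.prod ρ).map (fun z => z.1.1 + z.2) = μ.conv ρ := by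
    rw [Measure.conv, ← hπ.2.1, show (fun z : (E × E) × E => z.1.1 + z.2) =
      (fun z : E × E => z.1 + z.2) ∘ Prod.map Prod.fst id from rfl,
      ← Measure.map_map (by fun_prop) (by fun_prop),
      ← Measure.map_prod_map _ _ measurable_fst measurable_id, Measure.map_id]
  have h₂ : (π.prod ρ).map (fun z => z.1.2 + z.2) = ν.conv ρ := by
    rw [Measure.conv, ← hπ.2.2, show (fun z : (E × E) × E => z.1.2 + z.2) =
      (fun z : E × E => z.1 + z.2) ∘ Prod.map Prod.snd id from rfl,
      ← Measure.map_map (by fun_prop) (by fun_prop),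
      ← Measure.map_prod_map _ _ measurable_snd measurable_id, Measure.map_id]
  rw [← h₁, ← h₂]
  refine (W2_map_le (by fun_prop) (by fun_prop)).trans_eq ?_
  have h₃ : (π.prod ρ).map Prod.fst = π := by simp
  conv_rhs => rw [← h₃, eLpNorm_map_measure (by fun_prop) (by fun_prop)]
  congr 2
  ext z
  simp

lemma W2_conv_self_le (μ ρ : Measure E) [IsProbabilityMeasure μ] [IsProbabilityMeasure ρ] :
    W2 μ (μ.conv ρ) ≤ costFactor * eLpNorm id 2 ρ := by
  have h := W2_map_le (P := μ.prod ρ) (X := Prod.fst) (Y := fun z => z.1 + z.2)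
    measurable_fst (by fun_prop)
  rw [Measure.map_fst_prod, measure_univ, one_smul, ← Measure.conv] at h
  refine h.trans_eq ?_
  have h₃ : (μ.prod ρ).map Prod.snd = ρ := by simp
  conv_rhs => rw [← h₃, eLpNorm_map_measure (by fun_prop) (by fun_prop), ← eLpNorm_neg]
  congr 2
  ext z
  simp

lemma W2_dirac_zero (μ : Measure E) [IsProbabilityMeasure μ] :
    W2 μ (Measure.dirac 0) = costFactor * eLpNorm id 2 μ := by
  refine le_antisymm ?_ ?_
  · have h := W2_map_le (P := μ) measurable_id (measurable_const (a := (0 : E)))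
    simpa [Measure.map_const, Function.id_def] using h
  · rw [W2_eq_iInf]
    refine le_iInf₂ fun π hπ => ?_
    have h0 : ∀ᵐ z ∂π, z.2 = 0 := by
      have : ∀ᵐ y ∂(π.map Prod.snd), y = 0 := by
        rw [hπ.2.2, ae_dirac_eq]
        rfl
      exact ae_of_ae_map measurable_snd.aemeasurable this
    rw [← hπ.2.1, eLpNorm_map_measure (by fun_prop) (by fun_prop)]
    refine mul_le_mul_right (le_of_eq (eLpNorm_congr_ae ?_)) _
    filter_upwards [h0] with z hz
    simp [hz]

lemma W2_dirac_le (x y : E) :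
    W2 (Measure.dirac x) (Measure.dirac y) ≤ costFactor * ‖x - y‖ₑ := by
  have h := W2_map_le (P := (Measure.dirac () : Measure Unit)) (measurable_const (a := x))
    (measurable_const (a := y))
  simpa [Measure.map_const, eLpNorm_const] using h

lemma eq_of_W2_eq_zero [InnerProductSpace ℝ E] [CompleteSpace E] {μ ν : Measure E}
    [IsProbabilityMeasure μ] [IsProbabilityMeasure ν] (h : W2 μ ν = 0) : μ = ν := by
  refine Measure.ext_of_charFun (funext fun t => ?_)
  have key : ∀ ε : ℝ, 0 < ε → ‖charFun μ t - charFun ν t‖ ≤ ε * ‖t‖ := by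
    intro ε hε
    have hlt : W2 μ ν < costFactor * ENNReal.ofReal ε := by
      rw [h]
      exact ENNReal.mul_pos costFactor_ne_zero (by simpa using hε)
    obtain ⟨π, hπ, hlt⟩ := exists_coupling_lt hlt
    have := hπ.1
    have hlt2 : eLpNorm (fun z : E × E => z.1 - z.2) 2 π < ENNReal.ofReal ε :=
      lt_of_mul_lt_mul_left' hlt
    have hL1 : eLpNorm (fun z : E × E => z.1 - z.2) 1 π ≤ ENNReal.ofReal ε :=
      (eLpNorm_le_eLpNorm_of_exponent_le (by norm_num) (by fun_prop)).trans hlt2.le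
    have hmem : MemLp (fun z : E × E => z.1 - z.2) 1 π :=
      ⟨by fun_prop, hL1.trans_lt ENNReal.ofReal_lt_top⟩
    have hint : Integrable (fun z : E × E => z.1 - z.2) π := memLp_one_iff_integrable.1 hmem
    have hI : ∫ z : E × E, ‖z.1 - z.2‖ ∂π ≤ ε := by
      rw [integral_norm_eq_lintegral_enorm (by fun_prop)]
      rw [eLpNorm_one_eq_lintegral_enorm] at hL1
      exact ENNReal.toReal_le_of_le_ofReal hε.le hL1
    have hb : ∀ x : ℝ, ‖Complex.exp (x * Complex.I)‖ = 1 := fun x =>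
      Complex.norm_exp_ofReal_mul_I x
    have hi : ∀ g : E × E → ℝ, Measurable g →
        Integrable (fun z => Complex.exp (g z * Complex.I)) π := by
      intro g hg
      refine Integrable.of_bound (C := 1) (by fun_prop) (ae_of_all _ fun z => (hb _).le)
    rw [← hπ.2.1, ← hπ.2.2, charFun_apply, charFun_apply, integral_map (by fun_prop) (by fun_prop),
      integral_map (by fun_prop) (by fun_prop),
      ← integral_sub (hi _ (by fun_prop)) (hi _ (by fun_prop))]
    calc _ ≤ ∫ z : E × E, ‖t‖ * ‖z.1 - z.2‖ ∂π := by
          refine norm_integral_le_of_norm_le (hint.norm.const_mul _) (ae_of_all _ fun z => ?_)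
          have e : Complex.exp ((inner ℝ z.1 t : ℝ) * Complex.I) -
              Complex.exp ((inner ℝ z.2 t : ℝ) * Complex.I) =
              Complex.exp ((inner ℝ z.2 t : ℝ) * Complex.I) *
                (Complex.exp (Complex.I * (inner ℝ (z.1 - z.2) t : ℝ)) - 1) := by
            rw [mul_sub, ← Complex.exp_add, inner_sub_left]
            push_cast
            ring_nf
          rw [e, norm_mul, hb, one_mul]
          refine Real.norm_exp_I_mul_ofReal_sub_one_le.trans ?_
          rw [mul_comm]
          exact norm_inner_le_norm _ _
      _ = ‖t‖ * ∫ z : E × E, ‖z.1 - z.2‖ ∂π := integral_const_mul _ _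
      _ ≤ ε * ‖t‖ := by rw [mul_comm]; gcongr
  have h0 : ‖charFun μ t - charFun ν t‖ ≤ 0 := by
    refine le_of_forall_pos_le_add fun δ hδ => ?_
    have hp : 0 < ‖t‖ + 1 := by positivity
    refine (key (δ / (‖t‖ + 1)) (by positivity)).trans ?_
    rw [zero_add, div_mul_eq_mul_div, div_le_iff₀ hp]
    nlinarith
  exact sub_eq_zero.1 (norm_le_zero_iff.1 h0)

end Wasserstein

section Discretization

lemma mem_couplings_of_lintegral {E : Type*} [MeasurableSpace E] {μ ν : Measure E}
    [IsProbabilityMeasure μ] {π : Measure (E × E)}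
    (h₁ : ∀ f : E → ℝ≥0∞, Measurable f → ∫⁻ z, f z.1 ∂π = ∫⁻ x, f x ∂μ)
    (h₂ : ∀ f : E → ℝ≥0∞, Measurable f → ∫⁻ z, f z.2 ∂π = ∫⁻ x, f x ∂ν) :
    π ∈ couplings μ ν := by
  refine ⟨⟨?_⟩, ?_, ?_⟩
  · simpa using h₁ (fun _ => 1) measurable_const
  · refine Measure.ext_of_lintegral _ fun f hf => ?_
    rw [lintegral_map hf measurable_fst, h₁ f hf]
  · refine Measure.ext_of_lintegral _ fun f hf => ?_
    rw [lintegral_map hf measurable_snd, h₂ f hf]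

/-- The measure with mass `a i` at the point `p i`. -/
def discreteMeasure {ι α : Type*} [Fintype ι] [MeasurableSpace α] (a : ι → ℝ≥0∞) (p : ι → α) :
    Measure α :=
  ∑ i, a i • Measure.dirac (p i)

lemma lintegral_discreteMeasure {ι α : Type*} [Fintype ι] [MeasurableSpace α]
    (a : ι → ℝ≥0∞) (p : ι → α) {f : α → ℝ≥0∞} (hf : Measurable f) :
    ∫⁻ x, f x ∂discreteMeasure a p = ∑ i, a i * f (p i) := by
  rw [discreteMeasure, lintegral_finsetSum_measure]
  refine Finset.sum_congr rfl fun i _ => ?_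
  rw [lintegral_smul_measure, lintegral_dirac' _ hf, smul_eq_mul]

lemma isProbabilityMeasure_discreteMeasure {ι α : Type*} [Fintype ι] [MeasurableSpace α]
    {a : ι → ℝ≥0∞} (ha : ∑ i, a i = 1) (p : ι → α) :
    IsProbabilityMeasure (discreteMeasure a p) := by
  constructor
  rw [← lintegral_one, lintegral_discreteMeasure a p measurable_const]
  simpa using ha

variable {E : Type*} [NormedAddCommGroup E] [MeasurableSpace E]

lemma W2_sq_le_of_mem {μ ν : Measure E} {π : Measure (E × E)} (h : π ∈ couplings μ ν) :
    W2 μ ν ^ 2 ≤ 1 / 2 * ∫⁻ z : E × E, ‖z.1 - z.2‖ₑ ^ 2 ∂π := by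
  calc W2 μ ν ^ 2 ≤ (costFactor * eLpNorm (fun z : E × E => z.1 - z.2) 2 π) ^ 2 := by
        gcongr
        exact W2_le_of_mem h
    _ = _ := by rw [mul_pow, costFactor_sq, eLpNorm_two_sq]

variable [BorelSpace E] [SecondCountableTopology E]

/-- Transporting the piece of density `w i` of `μ` to the point `p i`. -/
lemma W2_discretization_sq_le {ι : Type*} [Fintype ι] {w : ι → E → ℝ≥0}
    (hw : ∀ i, Measurable (w i)) (hsum : ∀ x, ∑ i, w i x = 1) (p : ι → E)
    (μ : Measure E) [IsProbabilityMeasure μ] :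
    W2 μ (discreteMeasure (fun i => ∫⁻ x, w i x ∂μ) p) ^ 2 ≤
      1 / 2 * ∑ i, ∫⁻ x, w i x * ‖x - p i‖ₑ ^ 2 ∂μ := by
  let π : Measure (E × E) :=
    ∑ i, (μ.withDensity fun x => (w i x : ℝ≥0∞)).map fun x => (x, p i)
  have hπ : ∀ f : E × E → ℝ≥0∞, Measurable f →
      ∫⁻ z, f z ∂π = ∑ i, ∫⁻ x, w i x * f (x, p i) ∂μ := by
    intro f hf
    rw [lintegral_finsetSum_measure]
    refine Finset.sum_congr rfl fun i _ => ?_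
    have := hw i
    rw [lintegral_map hf (by fun_prop),
      lintegral_withDensity_eq_lintegral_mul _ (by fun_prop) (by fun_prop)]
    rfl
  rw [← hπ (fun z => ‖z.1 - z.2‖ₑ ^ 2) (by fun_prop)]
  refine W2_sq_le_of_mem (mem_couplings_of_lintegral (fun f hf => ?_) fun f hf => ?_)
  · rw [hπ (fun z => f z.1) (by fun_prop),
      ← lintegral_finsetSum _ fun i _ => by have := hw i; fun_prop]
    refine lintegral_congr fun x => ?_
    simp only
    rw [← Finset.sum_mul, ← ENNReal.ofNNReal_finsetSum, hsum, ENNReal.coe_one, one_mul]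
  · rw [hπ (fun z => f z.2) (by fun_prop), lintegral_discreteMeasure _ _ hf]
    refine Finset.sum_congr rfl fun i _ => ?_
    have := hw i
    simp only
    rw [lintegral_mul_const _ (by fun_prop)]

lemma W2_discreteMeasure_sq_le {ι : Type*} [Fintype ι] {a b : ι → ℝ≥0∞} (ha : ∑ i, a i = 1)
    (hb : ∑ i, b i = 1) (p : ι → E) :
    W2 (discreteMeasure a p) (discreteMeasure b p) ^ 2 ≤
      1 / 2 * ((1 - ∑ i, min (a i) (b i)) * ∑ i, ∑ j, ‖p i - p j‖ₑ ^ 2) := by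
  classical
  set m : ι → ℝ≥0∞ := fun i => min (a i) (b i) with hm
  set δ : ℝ≥0∞ := 1 - ∑ i, m i with hδ
  have hδtop : δ ≠ ∞ := (tsub_le_self.trans_lt ENNReal.one_lt_top).ne
  have hmtop : ∑ i, m i ≠ ∞ := by
    refine ((Finset.sum_le_sum fun i _ => min_le_left (a i) (b i)).trans_lt ?_).ne
    rw [ha]; exact ENNReal.one_lt_top
  have hsub : ∀ c : ι → ℝ≥0∞, (∀ i, m i ≤ c i) → ∑ i, c i = 1 → ∑ i, (c i - m i) = δ := by
    intro c hc h1
    have h : ∑ i, (c i - m i) + ∑ i, m i = 1 := by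
      rw [← Finset.sum_add_distrib, ← h1]
      exact Finset.sum_congr rfl fun i _ => tsub_add_cancel_of_le (hc i)
    rw [hδ, ← h, ENNReal.add_sub_cancel_right hmtop]
  have hma : ∀ i, m i ≤ a i := fun i => min_le_left _ _
  have hmb : ∀ i, m i ≤ b i := fun i => min_le_right _ _
  have hsa := hsub a hma ha
  have hsb := hsub b hmb hb
  have hale : ∀ i, a i - m i ≤ δ := fun i =>
    hsa ▸ Finset.single_le_sum (f := fun i => a i - m i) (fun _ _ => zero_le) (Finset.mem_univ i)
  have hble : ∀ i, b i - m i ≤ δ := fun i =>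
    hsb ▸ Finset.single_le_sum (f := fun i => b i - m i) (fun _ _ => zero_le) (Finset.mem_univ i)
  have hcancel : ∀ c : ℝ≥0∞, c ≤ δ → c * (δ * δ⁻¹) = c := by
    intro c hc
    rcases eq_or_ne δ 0 with h0 | h0
    · rw [h0, nonpos_iff_eq_zero] at hc
      simp [hc]
    · rw [ENNReal.mul_inv_cancel h0 hδtop, mul_one]
  let c : ι × ι → ℝ≥0∞ := fun z =>
    (if z.1 = z.2 then m z.1 else 0) + (a z.1 - m z.1) * ((b z.2 - m z.2) * δ⁻¹)
  have hrow : ∀ i, ∑ j, c (i, j) = a i := by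
    intro i
    simp only [c, Finset.sum_add_distrib, ← Finset.mul_sum, ← Finset.sum_mul, hsb]
    rw [hcancel _ (hale i)]
    simp [add_tsub_cancel_of_le (hma i)]
  have hcol : ∀ j, ∑ i, c (i, j) = b j := by
    intro j
    simp only [c, Finset.sum_add_distrib, ← Finset.sum_mul, hsa]
    rw [mul_left_comm, hcancel _ (hble j)]
    simp [add_tsub_cancel_of_le (hmb j)]
  have := isProbabilityMeasure_discreteMeasure ha p
  have hπ : discreteMeasure c (fun z => (p z.1, p z.2)) ∈
      couplings (discreteMeasure a p) (discreteMeasure b p) := by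
    refine mem_couplings_of_lintegral (fun f hf => ?_) fun f hf => ?_
    · rw [lintegral_discreteMeasure c _ (f := fun z : E × E => f z.1) (by fun_prop),
        lintegral_discreteMeasure _ _ hf, Fintype.sum_prod_type]
      refine Finset.sum_congr rfl fun i _ => ?_
      simp only
      rw [← Finset.sum_mul, hrow]
    · rw [lintegral_discreteMeasure c _ (f := fun z : E × E => f z.2) (by fun_prop),
        lintegral_discreteMeasure _ _ hf, Fintype.sum_prod_type_right]
      refine Finset.sum_congr rfl fun i _ => ?_
      simp only
      rw [← Finset.sum_mul, hcol]
  refine (W2_sq_le_of_mem hπ).trans ?_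
  rw [lintegral_discreteMeasure c _ (f := fun z : E × E => ‖z.1 - z.2‖ₑ ^ 2) (by fun_prop),
    Fintype.sum_prod_type, Finset.mul_sum (a := δ)]
  simp_rw [Finset.mul_sum (a := δ)]
  refine mul_le_mul' le_rfl (Finset.sum_le_sum fun i _ => Finset.sum_le_sum fun j _ => ?_)
  rcases eq_or_ne i j with rfl | hij
  · simp
  · refine mul_le_mul' ?_ le_rfl
    simp only [c, if_neg hij, zero_add]
    refine (mul_le_mul' (hale i) (mul_le_mul_left (hble j) _)).trans ?_
    exact (hcancel δ le_rfl).le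

end Discretization

section WeakConvergence

variable {ι E : Type*} [NormedAddCommGroup E] [MeasurableSpace E] [BorelSpace E]
  {l : Filter ι} {μs : ι → ProbabilityMeasure E} {μ : ProbabilityMeasure E}

lemma tendsto_lintegral_of_bounded (h : Tendsto μs l (𝓝 μ)) {G : E → ℝ≥0} (hG : Continuous G)
    {C : ℝ≥0} (hC : ∀ x, G x ≤ C) :
    Tendsto (fun n => ∫⁻ x, G x ∂(μs n : Measure E)) l (𝓝 (∫⁻ x, G x ∂(μ : Measure E))) := by
  refine ProbabilityMeasure.tendsto_iff_forall_lintegral_tendsto.1 h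
    (BoundedContinuousFunction.mkOfBound ⟨G, hG⟩ C fun x y => ?_)
  rw [NNReal.dist_eq]
  exact abs_sub_le_of_nonneg_of_le (NNReal.coe_nonneg _) (hC x) (NNReal.coe_nonneg _) (hC y)

variable [ProperSpace E] [SecondCountableTopology E]

/-- Weak convergence together with convergence of the integrals of a continuous function
dominating `‖x‖²` implies convergence in the Wasserstein distance. -/
theorem tendsto_W2_of_tendsto_of_tendsto_lintegral (h : Tendsto μs l (𝓝 μ)) {F : E → ℝ≥0}
    (hF : Continuous F) (hle : ∀ x, ‖x‖₊ ^ 2 ≤ F x)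
    (hint : Tendsto (fun n => ∫⁻ x, F x ∂(μs n : Measure E)) l (𝓝 (∫⁻ x, F x ∂(μ : Measure E))))
    (hfin : ∫⁻ x, F x ∂(μ : Measure E) ≠ ∞) :
    Tendsto (fun n => W2 (μs n : Measure E) (μ : Measure E)) l (𝓝 0) := by
  suffices H : ∀ ε : ℝ≥0, 0 < ε →
      ∀ᶠ n in l, W2 (μs n : Measure E) (μ : Measure E) ≤ 5 * ε by
    refine ENNReal.tendsto_nhds_zero.2 fun η hη => ?_
    obtain ⟨ε, hε, hεη⟩ := ENNReal.lt_iff_exists_nnreal_btwn.1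
      (ENNReal.div_pos hη.ne' (by norm_num) : 0 < η / 5)
    filter_upwards [H ε (by exact_mod_cast hε)] with n hn
    refine hn.trans ?_
    rw [mul_comm]
    exact (ENNReal.le_div_iff_mul_le (by norm_num) (by norm_num)).1 hεη.le
  intro ε hε
  -- the tail of `F`
  obtain ⟨R, hR⟩ : ∃ R : ℕ,
      ∫⁻ x in (Metric.closedBall 0 (R : ℝ))ᶜ, F x ∂(μ : Measure E) ≤ (ε : ℝ≥0∞) ^ 2 := by
    have ht : Tendsto (fun R : ℕ => (μ : Measure E) (Metric.closedBall 0 (R : ℝ))ᶜ) atTop (𝓝 0) := by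
      have hi : ⋂ R : ℕ, (Metric.closedBall (0 : E) (R : ℝ))ᶜ = ∅ := by
        rw [← Set.compl_iUnion, Metric.iUnion_closedBall_nat, Set.compl_univ]
      rw [← measure_empty (μ := (μ : Measure E)), ← hi]
      refine tendsto_measure_iInter_atTop
        (fun R => Metric.isClosed_closedBall.measurableSet.compl.nullMeasurableSet) ?_
        ⟨0, measure_ne_top _ _⟩
      intro a b hab
      exact Set.compl_subset_compl.2 (Metric.closedBall_subset_closedBall (by exact_mod_cast hab))
    have := tendsto_setLIntegral_zero hfin ht
    have hpos : (0 : ℝ≥0∞) < (ε : ℝ≥0∞) ^ 2 := by positivity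
    exact ((ENNReal.tendsto_nhds_zero.1 this) _ hpos).exists
  obtain ⟨t, -, htfin, hcov⟩ :=
    (isCompact_closedBall (0 : E) (R : ℝ)).finite_cover_balls (e := (ε : ℝ)) (by exact_mod_cast hε)
  have := htfin.fintype
  -- the partition of unity
  let g : Option t → E → ℝ≥0 := fun i x =>
    i.elim (Real.toNNReal (‖x‖ - R)) fun p => Real.toNNReal (ε - dist x p)
  let p : Option t → E := fun i => i.elim 0 fun p => p
  have hg : ∀ i, Continuous (g i) := by
    rintro (_ | q)
    · simp only [g, Option.elim]; fun_prop
    · simp only [g, Option.elim]; fun_prop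
  have hSpos : ∀ x, ∑ i, g i x ≠ 0 := by
    intro x h0
    rw [Finset.sum_eq_zero_iff] at h0
    by_cases hx : ‖x‖ ≤ R
    · obtain ⟨q, hq, hxq⟩ := Set.mem_iUnion₂.1 (hcov (mem_closedBall_zero_iff.2 hx))
      have := h0 (some ⟨q, hq⟩) (Finset.mem_univ _)
      simp only [g, Option.elim, Real.toNNReal_eq_zero, sub_nonpos] at this
      exact absurd (Metric.mem_ball.1 hxq) (not_lt.2 this)
    · have := h0 none (Finset.mem_univ _)
      simp only [g, Option.elim, Real.toNNReal_eq_zero, sub_nonpos] at this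
      exact hx this
  let w : Option t → E → ℝ≥0 := fun i x => g i x / ∑ j, g j x
  have hw : ∀ i, Continuous (w i) := fun i =>
    (hg i).div (continuous_finsetSum _ fun j _ => hg j) hSpos
  have hwsum : ∀ x, ∑ i, w i x = 1 := fun x => by
    simp only [w, ← Finset.sum_div]
    exact div_self (hSpos x)
  have hw1 : ∀ i x, w i x ≤ 1 := fun i x =>
    hwsum x ▸ Finset.single_le_sum (f := fun i => w i x) (fun _ _ => zero_le) (Finset.mem_univ i)
  have hwzero : ∀ i x, g i x = 0 → w i x = 0 := fun i x hi => by simp [w, hi]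
  have hnear : ∀ (q : t) x, w (some q) x ≠ 0 → dist x q < ε := by
    intro q x hne
    by_contra! hcon
    refine hne (hwzero _ _ ?_)
    simpa [g] using hcon
  -- the cost of the discretization
  let D : Measure E → ℝ≥0∞ := fun ν => ε ^ 2 + ∫⁻ x, (w none x * F x : ℝ≥0) ∂ν
  let Q : Measure E → Measure E := fun ν => discreteMeasure (fun i => ∫⁻ x, w i x ∂ν) p
  have hQ : ∀ ν : Measure E, IsProbabilityMeasure ν → W2 ν (Q ν) ^ 2 ≤ 1 / 2 * D ν := by
    intro ν _
    refine (W2_discretization_sq_le (fun i => (hw i).measurable) hwsum p ν).trans ?_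
    gcongr
    rw [← lintegral_finsetSum _ fun i _ => by have := (hw i).measurable; fun_prop]
    have hc : D ν = ∫⁻ x, ((ε : ℝ≥0∞) ^ 2 + (w none x * F x : ℝ≥0)) ∂ν := by
      rw [lintegral_add_left measurable_const]
      simp [D]
    rw [hc]
    refine lintegral_mono fun x => ?_
    rw [Fintype.sum_option, add_comm]
    refine add_le_add ?_ ?_
    · calc ∑ q : t, (w (some q) x : ℝ≥0∞) * ‖x - q‖ₑ ^ 2
          ≤ ∑ q : t, (w (some q) x : ℝ≥0∞) * ε ^ 2 := by
            refine Finset.sum_le_sum fun q _ => ?_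
            by_cases h0 : w (some q) x = 0
            · simp [h0]
            · have := hnear q x h0
              rw [dist_eq_norm] at this
              gcongr
              rw [enorm_eq_nnnorm]
              exact_mod_cast this.le
        _ ≤ 1 * ε ^ 2 := by
            rw [← Finset.sum_mul, ← ENNReal.ofNNReal_finsetSum]
            gcongr
            rw [ENNReal.coe_le_one_iff, ← hwsum x, Fintype.sum_option]
            exact le_add_self
        _ = _ := one_mul _
    · rw [ENNReal.coe_mul]
      gcongr
      simp only [p, Option.elim, sub_zero, enorm_eq_nnnorm]
      exact_mod_cast hle x
  have hDμ : D μ ≤ 2 * ε ^ 2 := by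
    rw [two_mul]
    refine add_le_add le_rfl (le_trans ?_ hR)
    rw [← lintegral_indicator Metric.isClosed_closedBall.measurableSet.compl]
    refine lintegral_mono fun x => ?_
    by_cases hx : x ∈ Metric.closedBall (0 : E) (R : ℝ)
    · have : w none x = 0 := hwzero _ _ (by
        simp only [g, Option.elim, Real.toNNReal_eq_zero, sub_nonpos]
        exact mem_closedBall_zero_iff.1 hx)
      simp [this]
    · rw [Set.indicator_of_mem (by exact hx)]
      exact ENNReal.coe_le_coe.2 (mul_le_of_le_one_left zero_le (hw1 none x))
  have hDlim : Tendsto (fun n => D (μs n)) l (𝓝 (D μ)) := by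
    refine Tendsto.add tendsto_const_nhds ?_
    have hG : Continuous fun x => (1 - w none x) * F x := (continuous_const.sub (hw none)).mul hF
    have hsplit : ∀ ν : Measure E, ∫⁻ x, F x ∂ν =
        ∫⁻ x, (w none x * F x : ℝ≥0) ∂ν + ∫⁻ x, ((1 - w none x) * F x : ℝ≥0) ∂ν := by
      intro ν
      have hm : Measurable fun x => ((w none x * F x : ℝ≥0) : ℝ≥0∞) :=
        ((hw none).mul hF).measurable.coe_nnreal_ennreal
      rw [← lintegral_add_left hm]
      refine lintegral_congr fun x => ?_
      rw [← ENNReal.coe_add, ← add_mul, add_tsub_cancel_of_le (hw1 none x), one_mul]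
    obtain ⟨C, hC⟩ : ∃ C : ℝ≥0, ∀ x, (1 - w none x) * F x ≤ C := by
      have hK : IsCompact (⋃ q ∈ t, Metric.closedBall q (ε : ℝ)) :=
        htfin.isCompact_biUnion fun q _ => isCompact_closedBall _ _
      obtain ⟨C, hC⟩ := hK.bddAbove_image hF.continuousOn
      refine ⟨C, fun x => ?_⟩
      by_cases hx : x ∈ ⋃ q ∈ t, Metric.closedBall q (ε : ℝ)
      · exact (mul_le_of_le_one_left zero_le tsub_le_self).trans (hC ⟨x, hx, rfl⟩)
      · have : w none x = 1 := by
          rw [← hwsum x, Fintype.sum_option, left_eq_add]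
          refine Finset.sum_eq_zero fun q _ => ?_
          by_contra hne
          exact hx (Set.mem_iUnion₂.2 ⟨q, q.2, (hnear q x hne).le⟩)
        simp [this]
    have hGlim := tendsto_lintegral_of_bounded h hG hC
    have hGtop : ∀ ν : ProbabilityMeasure E,
        ∫⁻ x, ((1 - w none x) * F x : ℝ≥0) ∂(ν : Measure E) ≠ ∞ := by
      intro ν
      refine ((lintegral_mono (g := fun _ => (C : ℝ≥0∞))
        fun x => ENNReal.coe_le_coe.2 (hC x)).trans_lt ?_).ne
      simp
    have hsub : ∀ ν : ProbabilityMeasure E, ∫⁻ x, (w none x * F x : ℝ≥0) ∂(ν : Measure E) =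
        ∫⁻ x, F x ∂(ν : Measure E) - ∫⁻ x, ((1 - w none x) * F x : ℝ≥0) ∂(ν : Measure E) := by
      intro ν
      rw [hsplit, ENNReal.add_sub_cancel_right (hGtop ν)]
    simp_rw [hsub]
    exact ENNReal.Tendsto.sub hint hGlim (Or.inl hfin)
  have hwint : ∀ ν : ProbabilityMeasure E, ∑ i, ∫⁻ x, w i x ∂(ν : Measure E) = 1 := by
    intro ν
    rw [← lintegral_finsetSum _ fun i _ => by have := (hw i).measurable; fun_prop]
    simp_rw [← ENNReal.ofNNReal_finsetSum, hwsum]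
    simp
  have hQlim : Tendsto (fun n => W2 (Q (μs n)) (Q μ) ^ 2) l (𝓝 0) := by
    refine tendsto_of_tendsto_of_tendsto_of_le_of_le tendsto_const_nhds ?_ (fun _ => zero_le)
      fun n => W2_discreteMeasure_sq_le (hwint (μs n)) (hwint μ) p
    have hM : ∑ i, ∑ j, ‖p i - p j‖ₑ ^ 2 ≠ ∞ := by
      simp [ENNReal.sum_eq_top]
    have h1 : Tendsto (fun n => ∑ i, min (∫⁻ x, w i x ∂(μs n : Measure E))
        (∫⁻ x, w i x ∂(μ : Measure E))) l (𝓝 1) := by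
      rw [← hwint μ]
      refine tendsto_finsetSum _ fun i _ => ?_
      have := (tendsto_lintegral_of_bounded h (hw i) (hw1 i)).min
        (tendsto_const_nhds (x := ∫⁻ x, w i x ∂(μ : Measure E)))
      rwa [min_self] at this
    have h2 := ENNReal.Tendsto.sub (tendsto_const_nhds (x := (1 : ℝ≥0∞))) h1
      (Or.inl ENNReal.one_ne_top)
    rw [tsub_self] at h2
    have h3 := ENNReal.Tendsto.const_mul (a := 1 / 2)
      (ENNReal.Tendsto.mul_const h2 (Or.inr hM)) (Or.inr (by simp))
    simpa using h3
  have hε2 : (0 : ℝ≥0∞) < (ε : ℝ≥0∞) ^ 2 := by positivity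
  have hε2top : (ε : ℝ≥0∞) ^ 2 ≠ ∞ := by simp
  have hDle : ∀ ν : Measure E, IsProbabilityMeasure ν → D ν ≤ 4 * ε ^ 2 → W2 ν (Q ν) ≤ 2 * ε := by
    intro ν hν hD
    refine ENNReal.le_of_sq_le_sq ((hQ ν hν).trans ?_)
    calc 1 / 2 * D ν ≤ 1 * (4 * ε ^ 2) := by
          gcongr
          simp
      _ = (2 * (ε : ℝ≥0∞)) ^ 2 := by ring
  have h4 : D μ < 4 * ε ^ 2 := by
    refine hDμ.trans_lt ?_
    rw [ENNReal.mul_lt_mul_iff_left hε2.ne' hε2top]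
    norm_num
  filter_upwards [hDlim.eventually_lt_const h4, hQlim.eventually_lt_const hε2] with n hn₁ hn₂
  calc W2 (μs n : Measure E) (μ : Measure E)
      ≤ W2 (μs n : Measure E) (Q (μs n)) + (W2 (Q (μs n)) (Q μ) + W2 (Q μ) μ) :=
        (W2_triangle _ (Q (μs n)) _).trans (add_le_add le_rfl (W2_triangle _ _ _))
    _ ≤ 2 * ε + (ε + 2 * ε) := by
        gcongr
        · exact hDle _ inferInstance hn₁.le
        · exact ENNReal.le_of_sq_le_sq hn₂.le
        · rw [W2_comm]
          exact hDle _ inferInstance h4.le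
    _ = 5 * ε := by ring

end WeakConvergence

section SecondMoment

variable {E : Type*} [NormedAddCommGroup E] [MeasurableSpace E]

/-- Probability measures with finite second moment. -/
class HasSecondMoment (μ : Measure E) : Prop extends IsProbabilityMeasure μ where
  eLpNorm_id_ne_top : eLpNorm id 2 μ ≠ ∞

lemma HasSecondMoment.of_lintegral_ne_top {μ : Measure E} [IsProbabilityMeasure μ]
    (h : ∫⁻ x, ‖x‖ₑ ^ 2 ∂μ ≠ ∞) : HasSecondMoment μ := by
  refine ⟨fun hμ => h ?_⟩
  have := eLpNorm_two_sq id μ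
  rw [hμ] at this
  exact this.symm

variable [BorelSpace E] [SecondCountableTopology E]

lemma HasSecondMoment.of_W2_ne_top {μ : Measure E} [IsProbabilityMeasure μ]
    (h : W2 μ (Measure.dirac 0) ≠ ∞) : HasSecondMoment μ := by
  refine ⟨fun hμ => h ?_⟩
  rw [W2_dirac_zero, hμ, ENNReal.mul_top costFactor_ne_zero]

lemma W2_dirac_zero_ne_top (μ : Measure E) [h : HasSecondMoment μ] :
    W2 μ (Measure.dirac 0) ≠ ∞ := by
  rw [W2_dirac_zero]
  exact ENNReal.mul_ne_top costFactor_ne_top h.eLpNorm_id_ne_top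

instance hasSecondMoment_dirac (x : E) : HasSecondMoment (Measure.dirac x) :=
  .of_W2_ne_top ((W2_dirac_le x 0).trans_lt
    (ENNReal.mul_lt_top costFactor_ne_top.lt_top (by simp))).ne

variable [CompleteSpace E]

lemma W2_ne_top (μ ν : Measure E) [HasSecondMoment μ] [HasSecondMoment ν] : W2 μ ν ≠ ∞ := by
  refine ((W2_triangle μ (Measure.dirac 0) ν).trans_lt ?_).ne
  rw [W2_comm (Measure.dirac 0)]
  exact ENNReal.add_lt_top.2 ⟨(W2_dirac_zero_ne_top μ).lt_top, (W2_dirac_zero_ne_top ν).lt_top⟩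

instance hasSecondMoment_conv (μ ρ : Measure E) [HasSecondMoment μ] [HasSecondMoment ρ] :
    HasSecondMoment (μ.conv ρ) := by
  refine .of_W2_ne_top ((W2_triangle _ μ _).trans_lt ?_).ne
  rw [W2_comm]
  refine ENNReal.add_lt_top.2 ⟨(W2_conv_self_le μ ρ).trans_lt ?_, (W2_dirac_zero_ne_top μ).lt_top⟩
  exact ENNReal.mul_lt_top costFactor_ne_top.lt_top HasSecondMoment.eLpNorm_id_ne_top.lt_top

end SecondMoment

section Truncation

/-- Truncation of the real line to `[-R, R]`. -/
def clamp (R x : ℝ) : ℝ := max (-R) (min R x)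

lemma lipschitzWith_clamp (R : ℝ) : LipschitzWith 1 (clamp R) :=
  (LipschitzWith.id.const_min R).const_max (-R)

lemma abs_clamp_le {R : ℝ} (hR : 0 ≤ R) (x : ℝ) : |clamp R x| ≤ R :=
  abs_le.2 ⟨le_max_left _ _, max_le (by linarith) (min_le_left _ _)⟩

lemma clamp_eq_self {R x : ℝ} (h : |x| ≤ R) : clamp R x = x := by
  rw [abs_le] at h
  rw [clamp, min_eq_right h.2, max_eq_right h.1]

lemma abs_sub_clamp_le {R : ℝ} (hR : 0 ≤ R) (x : ℝ) : |x - clamp R x| ≤ |x| := by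
  unfold clamp
  grind

lemma tendsto_W2_map_clamp (μ : Measure ℝ) [hμ : HasSecondMoment μ] :
    Tendsto (fun R : ℕ => W2 μ (μ.map (clamp R))) atTop (𝓝 0) := by
  have hlim : Tendsto (fun R : ℕ => ∫⁻ x, ‖x - clamp R x‖ₑ ^ 2 ∂μ) atTop (𝓝 (∫⁻ _, 0 ∂μ)) := by
    refine tendsto_lintegral_of_dominated_convergence (fun x => ‖x‖ₑ ^ 2) (fun R => ?_)
      (fun R => ae_of_all _ fun x => ?_) ?_ (ae_of_all _ fun x => ?_)
    · have := (lipschitzWith_clamp R).continuous.measurable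
      fun_prop
    · refine pow_le_pow_left' (enorm_le_iff_norm_le.2 ?_) 2
      exact abs_sub_clamp_le R.cast_nonneg x
    · rw [show ∫⁻ x, ‖x‖ₑ ^ 2 ∂μ = eLpNorm id 2 μ ^ 2 from (eLpNorm_two_sq id μ).symm]
      exact ENNReal.pow_ne_top hμ.eLpNorm_id_ne_top
    · refine tendsto_const_nhds.congr' ?_
      obtain ⟨N, hN⟩ := exists_nat_ge |x|
      filter_upwards [eventually_ge_atTop N] with R hR
      rw [clamp_eq_self (hN.trans (by exact_mod_cast hR))]
      simp
  rw [lintegral_zero] at hlim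
  have hsq : Tendsto (fun R : ℕ => costFactor * eLpNorm (fun x => x - clamp R x) 2 μ)
      atTop (𝓝 0) := by
    simp_rw [← eLpNorm_two_sq] at hlim
    have h := ENNReal.Tendsto.const_mul (a := costFactor)
      ((ENNReal.continuous_rpow_const (y := 1 / 2)).tendsto 0 |>.comp hlim) (Or.inr costFactor_ne_top)
    have he : ∀ a : ℝ≥0∞, (a ^ 2) ^ (2⁻¹ : ℝ) = a := fun a => by
      rw [← ENNReal.rpow_natCast, ← ENNReal.rpow_mul]
      norm_num
    simpa [Function.comp_def, he] using h
  refine tendsto_of_tendsto_of_tendsto_of_le_of_le tendsto_const_nhds hsq (fun _ => zero_le)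
    fun R => ?_
  have := W2_map_le (P := μ) measurable_id (lipschitzWith_clamp R).continuous.measurable
  simpa using this

/-- Lower semicontinuity of the Wasserstein distance under weak convergence on the line. -/
theorem W2_le_liminf {μs : ℕ → ProbabilityMeasure ℝ} {μ : ProbabilityMeasure ℝ} {ν : Measure ℝ}
    [HasSecondMoment (μ : Measure ℝ)] [HasSecondMoment ν] (h : Tendsto μs atTop (𝓝 μ)) :
    W2 (μ : Measure ℝ) ν ≤ liminf (fun n => W2 (μs n : Measure ℝ) ν) atTop := by
  refine le_of_forall_gt_imp_ge_of_dense fun c hc => ?_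
  have hfreq : ∃ᶠ n in atTop, W2 (μs n : Measure ℝ) ν < c :=
    frequently_lt_of_liminf_lt (by isBoundedDefault) hc
  have hclamp : ∀ R : ℕ, W2 ((μ : Measure ℝ).map (clamp R)) (ν.map (clamp R)) ≤ c := by
    intro R
    have hcont := (lipschitzWith_clamp R).continuous
    have hweak := ProbabilityMeasure.tendsto_map_of_tendsto_of_continuous μs μ h hcont
    have hlin : ∀ τ : ProbabilityMeasure ℝ,
        ∫⁻ x, (‖x‖₊ ^ 2 : ℝ≥0) ∂((τ : Measure ℝ).map (clamp R)) =
          ∫⁻ x, (‖clamp R x‖₊ ^ 2 : ℝ≥0) ∂(τ : Measure ℝ) := fun τ => by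
      rw [lintegral_map (by fun_prop) hcont.measurable]
    have hbound : ∀ x, ‖clamp R x‖₊ ^ 2 ≤ (R : ℝ≥0) ^ 2 := fun x =>
      pow_le_pow_left' (by exact_mod_cast abs_clamp_le R.cast_nonneg x) 2
    have hW := tendsto_W2_of_tendsto_of_tendsto_lintegral hweak (F := fun x => ‖x‖₊ ^ 2)
      (by fun_prop) (fun x => le_rfl)
      (by
        simp only [ProbabilityMeasure.toMeasure_map, hlin]
        exact tendsto_lintegral_of_bounded h (by fun_prop) hbound)
      (by
        simp only [ProbabilityMeasure.toMeasure_map, hlin]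
        refine ((lintegral_mono (g := fun _ => (((R : ℝ≥0) ^ 2 : ℝ≥0) : ℝ≥0∞))
          fun x => ENNReal.coe_le_coe.2 (hbound x)).trans_lt ?_).ne
        rw [lintegral_const, measure_univ, mul_one]
        exact ENNReal.coe_lt_top)
    have hadd := hW.add_const c
    rw [zero_add] at hadd
    refine ge_of_tendsto_of_frequently hadd (hfreq.mono fun n hn => ?_)
    refine (W2_triangle _ ((μs n : Measure ℝ).map (clamp R)) _).trans (add_le_add ?_ ?_)
    · rw [W2_comm]
      rfl
    · exact (W2_map_le_W2 (lipschitzWith_clamp R) _ _).trans hn.le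
  have hlim := ((tendsto_W2_map_clamp (μ : Measure ℝ)).add
    (tendsto_const_nhds (x := c))).add (tendsto_W2_map_clamp ν)
  rw [zero_add, add_zero] at hlim
  refine ge_of_tendsto' hlim fun R => ?_
  refine (W2_triangle _ (ν.map (clamp R)) _).trans (add_le_add ?_ (W2_comm _ _).le)
  exact (W2_triangle _ ((μ : Measure ℝ).map (clamp R)) _).trans (add_le_add le_rfl (hclamp R))

end Truncation

section Sliced

variable {k : ℕ}

local notation "𝔼" => EuclideanSpace ℝ (Fin k)

lemma sphereMeasure_univ_le_one : sphereMeasure k Set.univ ≤ 1 := by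
  rw [sphereMeasure, Measure.smul_apply, smul_eq_mul]
  exact ENNReal.inv_mul_le_one _

instance : IsFiniteMeasure (sphereMeasure k) :=
  ⟨sphereMeasure_univ_le_one.trans_lt ENNReal.one_lt_top⟩

instance : (sphereMeasure k).IsOpenPosMeasure :=
  Measure.isOpenPosMeasure_smul _ (ENNReal.inv_ne_zero.2 (measure_ne_top _ _))

instance isProbabilityMeasure_proj (μ : Measure 𝔼) [IsProbabilityMeasure μ] (θ : 𝔼) :
    IsProbabilityMeasure (proj μ θ) :=
  Measure.isProbabilityMeasure_map (by fun_prop)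

lemma lipschitzWith_inner {θ : 𝔼} (hθ : ‖θ‖ ≤ 1) : LipschitzWith 1 fun x : 𝔼 => inner ℝ x θ := by
  refine LipschitzWith.of_dist_le_mul fun x y => ?_
  rw [dist_eq_norm, dist_eq_norm, ← inner_sub_left, NNReal.coe_one, one_mul]
  exact (norm_inner_le_norm _ _).trans (mul_le_of_le_one_right (norm_nonneg _) hθ)

lemma W2_proj_le {θ : 𝔼} (hθ : ‖θ‖ ≤ 1) (μ ν : Measure 𝔼) :
    W2 (proj μ θ) (proj ν θ) ≤ W2 μ ν :=
  W2_map_le_W2 (lipschitzWith_inner hθ) μ ν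

lemma proj_dirac (x θ : 𝔼) : proj (Measure.dirac x) θ = Measure.dirac (inner ℝ x θ) := by
  have hm : Measurable fun y : 𝔼 => inner ℝ y θ := by fun_prop
  rw [proj, Measure.map_dirac' hm]

lemma hasSecondMoment_proj (μ : Measure 𝔼) [HasSecondMoment μ] {θ : 𝔼} (hθ : ‖θ‖ ≤ 1) :
    HasSecondMoment (proj μ θ) := by
  refine .of_W2_ne_top (ne_top_of_le_ne_top (W2_dirac_zero_ne_top μ) ?_)
  have := W2_proj_le hθ μ (Measure.dirac 0)
  rwa [proj_dirac, inner_zero_left] at this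

lemma W2_proj_proj_le (μ : Measure 𝔼) [IsProbabilityMeasure μ] (θ θ' : 𝔼) :
    W2 (proj μ θ) (proj μ θ') ≤ costFactor * eLpNorm id 2 μ * edist θ θ' := by
  refine (W2_map_le (by fun_prop) (by fun_prop)).trans ?_
  rw [mul_assoc]
  gcongr
  rw [mul_comm, edist_eq_enorm_sub, enorm_eq_nnnorm, ← smul_eq_mul, ← ENNReal.smul_def]
  refine eLpNorm_le_nnreal_smul_eLpNorm_of_ae_le_mul (ae_of_all _ fun x => ?_) 2
  rw [← inner_sub_right, mul_comm]
  exact nnnorm_inner_le_nnnorm _ _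

lemma continuous_W2_proj (μ ν : Measure 𝔼) [HasSecondMoment μ] [HasSecondMoment ν] :
    Continuous fun θ : 𝔼 => W2 (proj μ θ) (proj ν θ) := by
  refine continuous_of_le_add_edist
    (costFactor * eLpNorm id 2 μ + costFactor * eLpNorm id 2 ν) ?_ fun θ θ' => ?_
  · exact ENNReal.add_ne_top.2
      ⟨ENNReal.mul_ne_top costFactor_ne_top HasSecondMoment.eLpNorm_id_ne_top,
        ENNReal.mul_ne_top costFactor_ne_top HasSecondMoment.eLpNorm_id_ne_top⟩
  · calc W2 (proj μ θ) (proj ν θ)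
        ≤ W2 (proj μ θ) (proj μ θ') + (W2 (proj μ θ') (proj ν θ') + W2 (proj ν θ') (proj ν θ)) :=
          (W2_triangle _ _ _).trans (add_le_add le_rfl (W2_triangle _ _ _))
      _ ≤ _ := by
          rw [W2_comm (proj ν θ'), add_left_comm, add_mul]
          gcongr <;> exact W2_proj_proj_le _ _ _

lemma measurable_W2_proj (μ ν : Measure 𝔼) [HasSecondMoment μ] [HasSecondMoment ν] :
    Measurable fun θ : Metric.sphere (0 : 𝔼) 1 => W2 (proj μ θ) (proj ν θ) :=
  ((continuous_W2_proj μ ν).comp continuous_subtype_val).measurable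

lemma norm_sphere_le (θ : Metric.sphere (0 : 𝔼) 1) : ‖(θ : 𝔼)‖ ≤ 1 := by simp

lemma SW2_sq (μ ν : Measure 𝔼) :
    SW2 μ ν ^ 2 = ∫⁻ θ, W2 (proj μ θ) (proj ν θ) ^ 2 ∂sphereMeasure k := by
  rw [SW2, ← ENNReal.rpow_natCast, ← ENNReal.rpow_mul]
  norm_num

lemma SW2_le_W2 (μ ν : Measure 𝔼) : SW2 μ ν ≤ W2 μ ν := by
  refine ENNReal.le_of_sq_le_sq ?_
  rw [SW2_sq]
  calc _ ≤ ∫⁻ _, W2 μ ν ^ 2 ∂sphereMeasure k :=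
        lintegral_mono fun θ => pow_le_pow_left' (W2_proj_le (norm_sphere_le θ) μ ν) 2
    _ ≤ W2 μ ν ^ 2 := by
        rw [lintegral_const]
        exact mul_le_of_le_one_right zero_le sphereMeasure_univ_le_one

lemma SW2_ne_top (μ ν : Measure 𝔼) [HasSecondMoment μ] [HasSecondMoment ν] : SW2 μ ν ≠ ∞ :=
  ne_top_of_le_ne_top (W2_ne_top μ ν) (SW2_le_W2 μ ν)

lemma SW2_self (μ : Measure 𝔼) [IsProbabilityMeasure μ] : SW2 μ μ = 0 :=
  nonpos_iff_eq_zero.1 ((SW2_le_W2 μ μ).trans (W2_self μ).le)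

lemma SW2_comm (μ ν : Measure 𝔼) : SW2 μ ν = SW2 ν μ := by
  simp_rw [SW2, W2_comm]

lemma SW2_triangle (μ ν ρ : Measure 𝔼) [HasSecondMoment μ] [HasSecondMoment ν]
    [HasSecondMoment ρ] : SW2 μ ρ ≤ SW2 μ ν + SW2 ν ρ := by
  have h := ENNReal.lintegral_Lp_add_le (measurable_W2_proj μ ν).aemeasurable
    (measurable_W2_proj ν ρ).aemeasurable (μ := sphereMeasure k) (p := 2) (by norm_num)
  simp only [ENNReal.rpow_two] at h
  refine le_trans ?_ h
  unfold SW2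
  gcongr
  exact W2_triangle _ _ _

lemma charFun_proj (μ : Measure 𝔼) (θ : 𝔼) (t : ℝ) :
    charFun (proj μ θ) t = charFun μ (t • θ) := by
  rw [charFun_apply_real, proj, integral_map (by fun_prop) (by fun_prop), charFun_apply]
  simp_rw [inner_smul_right]
  push_cast
  rfl

lemma eq_of_SW2_eq_zero {μ ν : Measure 𝔼} [HasSecondMoment μ] [HasSecondMoment ν]
    (h : SW2 μ ν = 0) : μ = ν := by
  have hcont : Continuous fun θ : Metric.sphere (0 : 𝔼) 1 => W2 (proj μ θ) (proj ν θ) :=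
    (continuous_W2_proj μ ν).comp continuous_subtype_val
  have hzero : ∀ θ : Metric.sphere (0 : 𝔼) 1, W2 (proj μ θ) (proj ν θ) = 0 := by
    have h2 := SW2_sq μ ν
    rw [h, zero_pow two_ne_zero, eq_comm,
      lintegral_eq_zero_iff ((measurable_W2_proj μ ν).pow_const 2)] at h2
    have hae : (fun θ : Metric.sphere (0 : 𝔼) 1 => W2 (proj μ θ) (proj ν θ))
        =ᵐ[sphereMeasure k] fun _ => 0 := by
      filter_upwards [h2] with θ hθ
      exact pow_eq_zero_iff two_ne_zero |>.1 hθ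
    exact congrFun ((hcont.ae_eq_iff_eq _ continuous_const).1 hae)
  refine Measure.ext_of_charFun (funext fun x => ?_)
  rcases eq_or_ne x 0 with rfl | hx
  · simp
  · have hθ : ‖x‖⁻¹ • x ∈ Metric.sphere (0 : 𝔼) 1 := by
      rw [mem_sphere_zero_iff_norm, norm_smul, norm_inv, norm_norm,
        inv_mul_cancel₀ (norm_ne_zero_iff.2 hx)]
    have heq := eq_of_W2_eq_zero (hzero ⟨_, hθ⟩)
    have hx' : x = ‖x‖ • (‖x‖⁻¹ • x) := by
      rw [smul_smul, mul_inv_cancel₀ (norm_ne_zero_iff.2 hx), one_smul]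
    rw [hx', ← charFun_proj, ← charFun_proj]
    exact congrArg (fun m => charFun m ‖x‖) heq

/-- The squared sliced distance between the Dirac masses at `x` and at `0`. -/
def slicedSq (x : 𝔼) : ℝ≥0∞ :=
  ∫⁻ θ : Metric.sphere (0 : 𝔼) 1, 1 / 2 * ‖(inner ℝ x (θ : 𝔼) : ℝ)‖ₑ ^ 2 ∂sphereMeasure k

lemma measurable_slicedSq : Measurable (slicedSq (k := k)) := by
  refine Measurable.lintegral_prod_right' (f := fun z : 𝔼 × Metric.sphere (0 : 𝔼) 1 =>
    1 / 2 * ‖(inner ℝ z.1 (z.2 : 𝔼) : ℝ)‖ₑ ^ 2) ?_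
  fun_prop

lemma SW2_dirac_zero_sq (μ : Measure 𝔼) [IsProbabilityMeasure μ] :
    SW2 μ (Measure.dirac 0) ^ 2 = ∫⁻ x, slicedSq x ∂μ := by
  have h : ∀ θ : Metric.sphere (0 : 𝔼) 1, W2 (proj μ θ) (proj (Measure.dirac (0 : 𝔼)) θ) ^ 2 =
      ∫⁻ x, 1 / 2 * ‖(inner ℝ x (θ : 𝔼) : ℝ)‖ₑ ^ 2 ∂μ := by
    intro θ
    rw [proj_dirac, inner_zero_left, W2_dirac_zero, mul_pow, costFactor_sq, eLpNorm_two_sq, proj,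
      lintegral_map (by fun_prop) (by fun_prop), lintegral_const_mul _ (by fun_prop)]
    rfl
  simp_rw [SW2_sq, h, slicedSq]
  refine lintegral_lintegral_swap (Measurable.aemeasurable ?_)
  simp only [Function.uncurry_def]
  fun_prop

lemma SW2_dirac_dirac_zero_sq (x : 𝔼) :
    SW2 (Measure.dirac x) (Measure.dirac 0) ^ 2 = slicedSq x := by
  rw [SW2_dirac_zero_sq, lintegral_dirac]

lemma SW2_dirac_le (x y : 𝔼) : SW2 (Measure.dirac x) (Measure.dirac y) ≤ edist x y := by
  refine ((SW2_le_W2 _ _).trans (W2_dirac_le x y)).trans ?_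
  rw [edist_eq_enorm_sub]
  exact mul_le_of_le_one_left zero_le costFactor_le_one

lemma slicedSq_smul (r : ℝ) (x : 𝔼) : slicedSq (r • x) = ‖r‖ₑ ^ 2 * slicedSq x := by
  unfold slicedSq
  rw [← lintegral_const_mul' _ _ (by simp)]
  refine lintegral_congr fun θ => ?_
  rw [inner_smul_left, enorm_mul, mul_pow]
  simp only [conj_trivial]
  ring

lemma exists_enorm_le_SW2_dirac : ∃ K : ℝ≥0, ∀ x : 𝔼,
    ‖x‖ₑ ≤ K * SW2 (Measure.dirac x) (Measure.dirac 0) := by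
  have hcont : Continuous fun x : 𝔼 => SW2 (Measure.dirac x) (Measure.dirac 0) := by
    refine continuous_of_le_add_edist 1 ENNReal.one_ne_top fun x y => ?_
    rw [one_mul, add_comm]
    exact (SW2_triangle _ (Measure.dirac y) _).trans (add_le_add (SW2_dirac_le x y) le_rfl)
  have hunit : ∀ x : 𝔼, x ≠ 0 → ‖x‖⁻¹ • x ∈ Metric.sphere (0 : 𝔼) 1 := fun x hx => by
    rw [mem_sphere_zero_iff_norm, norm_smul, norm_inv, norm_norm,
      inv_mul_cancel₀ (norm_ne_zero_iff.2 hx)]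
  rcases (Metric.sphere (0 : 𝔼) 1).eq_empty_or_nonempty with he | hne
  · refine ⟨0, fun x => ?_⟩
    rcases eq_or_ne x 0 with rfl | hx
    · simp
    · exact absurd (hunit x hx) (he ▸ Set.notMem_empty _)
  obtain ⟨y, hy, hmin⟩ := (isCompact_sphere (0 : 𝔼) 1).exists_isMinOn hne hcont.continuousOn
  set m := SW2 (Measure.dirac y) (Measure.dirac (0 : 𝔼)) with hm
  have hm0 : m ≠ 0 := by
    intro h0
    have hy0 : y = 0 := dirac_eq_dirac_iff.1 (eq_of_SW2_eq_zero h0)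
    simp [hy0] at hy
  have hmtop : m ≠ ∞ := SW2_ne_top _ _
  refine ⟨(m⁻¹).toNNReal, fun x => ?_⟩
  rw [ENNReal.coe_toNNReal (ENNReal.inv_ne_top.2 hm0)]
  rcases eq_or_ne x 0 with rfl | hx
  · simp
  have hx' : x = ‖x‖ • (‖x‖⁻¹ • x) := by
    rw [smul_smul, mul_inv_cancel₀ (norm_ne_zero_iff.2 hx), one_smul]
  have hge : ‖x‖ₑ * m ≤ SW2 (Measure.dirac x) (Measure.dirac 0) := by
    refine ENNReal.le_of_sq_le_sq ?_
    rw [SW2_dirac_dirac_zero_sq]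
    conv_rhs => rw [hx', slicedSq_smul, enorm_norm, ← SW2_dirac_dirac_zero_sq]
    rw [mul_pow]
    gcongr
    exact hmin (hunit x hx)
  rw [mul_comm, ← div_eq_mul_inv, ENNReal.le_div_iff_mul_le (Or.inl hm0) (Or.inl hmtop)]
  exact hge

/-- A continuous function dominating `‖x‖²` whose `μ`-integral is an affine function of the
squared sliced distance from `μ ∗ ρ` to the Dirac mass at the origin. -/
lemma exists_moment_control (ρ : Measure 𝔼) [HasSecondMoment ρ] :
    ∃ (F : 𝔼 → ℝ≥0) (C D : ℝ≥0), Continuous F ∧ (∀ x, ‖x‖₊ ^ 2 ≤ F x) ∧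
      ∀ μ : Measure 𝔼, IsProbabilityMeasure μ →
        ∫⁻ x, F x ∂μ = C * SW2 (μ.conv ρ) (Measure.dirac 0) ^ 2 + D := by
  obtain ⟨K, hK⟩ := exists_enorm_le_SW2_dirac (k := k)
  let G : 𝔼 → ℝ≥0∞ := fun x => SW2 ((Measure.dirac x).conv ρ) (Measure.dirac 0)
  have hGtop : ∀ x, G x ≠ ∞ := fun x => SW2_ne_top _ _
  have hGcont : Continuous G := by
    refine continuous_of_le_add_edist 1 ENNReal.one_ne_top fun x y => ?_
    rw [one_mul, add_comm]
    refine (SW2_triangle _ ((Measure.dirac y).conv ρ) _).trans (add_le_add ?_ le_rfl)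
    refine ((SW2_le_W2 _ _).trans (W2_conv_le _ _ ρ)).trans ((W2_dirac_le x y).trans ?_)
    rw [edist_eq_enorm_sub]
    exact mul_le_of_le_one_left zero_le costFactor_le_one
  let B : ℝ≥0 := (costFactor * eLpNorm id 2 ρ).toNNReal
  have hB : (B : ℝ≥0∞) = costFactor * eLpNorm id 2 ρ :=
    ENNReal.coe_toNNReal (ENNReal.mul_ne_top costFactor_ne_top HasSecondMoment.eLpNorm_id_ne_top)
  let g : 𝔼 → ℝ≥0 := fun x => (G x).toNNReal
  have hg : ∀ x, (g x : ℝ≥0∞) = G x := fun x => ENNReal.coe_toNNReal (hGtop x)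
  have hgcont : Continuous g := ENNReal.continuousOn_toNNReal.comp_continuous hGcont hGtop
  refine ⟨fun x => 2 * K ^ 2 * g x ^ 2 + 2 * K ^ 2 * B ^ 2, 2 * K ^ 2, 2 * K ^ 2 * B ^ 2,
    by fun_prop, fun x => ?_, fun μ _ => ?_⟩
  · have h1 : ‖x‖₊ ≤ K * (B + g x) := by
      have : ‖x‖ₑ ≤ K * (B + G x) := by
        refine (hK x).trans ?_
        gcongr
        refine (SW2_triangle _ ((Measure.dirac x).conv ρ) _).trans (add_le_add ?_ le_rfl)
        rw [hB]
        exact (SW2_le_W2 _ _).trans (W2_conv_self_le _ _)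
      rw [← hg, enorm_eq_nnnorm] at this
      exact_mod_cast this
    calc ‖x‖₊ ^ 2 ≤ (K * (B + g x)) ^ 2 := pow_le_pow_left' h1 2
      _ = K ^ 2 * (B + g x) ^ 2 := mul_pow _ _ _
      _ ≤ K ^ 2 * (2 * (B ^ 2 + g x ^ 2)) := by
          gcongr
          exact add_sq_le
      _ = _ := by ring
  · have hint : ∫⁻ x, (g x : ℝ≥0∞) ^ 2 ∂μ = SW2 (μ.conv ρ) (Measure.dirac 0) ^ 2 := by
      rw [SW2_dirac_zero_sq, Measure.lintegral_conv measurable_slicedSq]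
      refine lintegral_congr fun x => ?_
      rw [hg, SW2_dirac_zero_sq, Measure.lintegral_conv measurable_slicedSq, lintegral_dirac]
    push_cast
    rw [lintegral_add_right _ measurable_const, lintegral_const_mul' _ _ (by finiteness), hint]
    simp

end Sliced

section Compactness

variable {E : Type*} [NormedAddCommGroup E] [MeasurableSpace E] [BorelSpace E]

lemma lintegral_sq_le_of_tendsto {μs : ℕ → ProbabilityMeasure E} {μ : ProbabilityMeasure E}
    (h : Tendsto μs atTop (𝓝 μ)) {M : ℝ≥0∞}
    (hM : ∀ n, ∫⁻ x, ‖x‖ₑ ^ 2 ∂(μs n : Measure E) ≤ M) :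
    ∫⁻ x, ‖x‖ₑ ^ 2 ∂(μ : Measure E) ≤ M := by
  have htrunc : ∀ R : ℕ, ∫⁻ x, (min (‖x‖₊ ^ 2) R : ℝ≥0) ∂(μ : Measure E) ≤ M := by
    intro R
    refine le_of_tendsto' (tendsto_lintegral_of_bounded h (G := fun x => min (‖x‖₊ ^ 2) R)
      (by fun_prop) fun x => min_le_right _ _) fun n => (lintegral_mono fun x => ?_).trans (hM n)
    rw [enorm_eq_nnnorm, ← ENNReal.coe_pow]
    exact ENNReal.coe_le_coe.2 (min_le_left _ _)
  refine le_of_tendsto' (lintegral_tendsto_of_tendsto_of_monotone (fun R => ?_)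
    (ae_of_all _ fun x => ?_) (ae_of_all _ fun x => ?_)) htrunc
  · fun_prop
  · intro a b hab
    refine ENNReal.coe_le_coe.2 (min_le_min le_rfl ?_)
    exact_mod_cast hab
  · refine tendsto_const_nhds.congr' ?_
    obtain ⟨N, hN⟩ := exists_nat_ge (‖x‖₊ ^ 2)
    filter_upwards [eventually_ge_atTop N] with R hR
    rw [min_eq_left (hN.trans (by exact_mod_cast hR)), enorm_eq_nnnorm, ENNReal.coe_pow]

variable [ProperSpace E] [SecondCountableTopology E]

lemma isTightMeasureSet_of_lintegral_sq_le {S : Set (Measure E)} {M : ℝ≥0∞} (hM : M ≠ ∞)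
    (hS : ∀ μ ∈ S, ∫⁻ x, ‖x‖ₑ ^ 2 ∂μ ≤ M) : IsTightMeasureSet S := by
  refine isTightMeasureSet_of_tendsto_measure_norm_gt ?_
  have hlim : Tendsto (fun r : ℝ => M / ENNReal.ofReal r ^ 2) atTop (𝓝 0) := by
    have h1 : Tendsto (fun r : ℝ => ENNReal.ofReal r ^ 2) atTop (𝓝 ∞) := by
      have := (ENNReal.continuous_pow 2).tendsto ∞ |>.comp ENNReal.tendsto_ofReal_atTop
      simpa [Function.comp_def] using this
    have := ENNReal.Tendsto.const_div h1 (Or.inr hM)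
    simpa using this
  refine tendsto_of_tendsto_of_tendsto_of_le_of_le' tendsto_const_nhds hlim
    (Eventually.of_forall fun _ => zero_le) ?_
  filter_upwards [eventually_gt_atTop 0] with r hr
  refine iSup₂_le fun μ hμ => ?_
  have hr' : ENNReal.ofReal r ^ 2 ≠ 0 := by simpa using hr
  refine le_trans (measure_mono fun x (hx : r < ‖x‖) => ?_)
    ((meas_ge_le_lintegral_div (f := fun x => ‖x‖ₑ ^ 2) (by fun_prop) hr' (by simp)).trans
      (ENNReal.div_le_div_right (hS μ hμ) _))
  change ENNReal.ofReal r ^ 2 ≤ ‖x‖ₑ ^ 2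
  rw [← ofReal_norm]
  gcongr

/-- A sequence of probability measures with bounded second moments has a weakly convergent
subsequence, and the limit has finite second moment. -/
lemma exists_subseq_tendsto {μs : ℕ → ProbabilityMeasure E} {M : ℝ≥0∞} (hM : M ≠ ∞)
    (hμs : ∀ n, ∫⁻ x, ‖x‖ₑ ^ 2 ∂(μs n : Measure E) ≤ M) :
    ∃ (μ : ProbabilityMeasure E) (φ : ℕ → ℕ), StrictMono φ ∧
      Tendsto (μs ∘ φ) atTop (𝓝 μ) ∧ HasSecondMoment (μ : Measure E) := by
  have htight : IsTightMeasureSet {((μ : ProbabilityMeasure E) : Measure E) | μ ∈ Set.range μs} := by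
    refine isTightMeasureSet_of_lintegral_sq_le hM ?_
    rintro _ ⟨_, ⟨n, rfl⟩, rfl⟩
    exact hμs n
  obtain ⟨μ, -, φ, hφ, hlim⟩ := (isCompact_closure_of_isTightMeasureSet htight).tendsto_subseq
    (x := μs) fun n => subset_closure (Set.mem_range_self n)
  exact ⟨μ, φ, hφ, hlim, .of_lintegral_ne_top (ne_top_of_le_ne_top hM
    (lintegral_sq_le_of_tendsto hlim fun n => hμs _))⟩

end Compactness

section Regularized

variable {k : ℕ}

local notation "𝔼" => EuclideanSpace ℝ (Fin k)

/-- Lower semicontinuity of the sliced distance under weak convergence. -/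
lemma SW2_le_of_tendsto {μs : ℕ → ProbabilityMeasure 𝔼} {μ : ProbabilityMeasure 𝔼}
    {ν : Measure 𝔼} [∀ n, HasSecondMoment (μs n : Measure 𝔼)] [HasSecondMoment (μ : Measure 𝔼)]
    [HasSecondMoment ν] (h : Tendsto μs atTop (𝓝 μ)) {c : ℝ≥0∞}
    (hc : ∀ᶠ n in atTop, SW2 (μs n : Measure 𝔼) ν ≤ c) : SW2 (μ : Measure 𝔼) ν ≤ c := by
  refine ENNReal.le_of_sq_le_sq ?_
  rw [SW2_sq]
  calc ∫⁻ θ, W2 (proj (μ : Measure 𝔼) θ) (proj ν θ) ^ 2 ∂sphereMeasure k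
      ≤ ∫⁻ θ, liminf (fun n => W2 (proj (μs n : Measure 𝔼) θ) (proj ν θ) ^ 2) atTop
          ∂sphereMeasure k := by
        refine lintegral_mono fun θ => ?_
        have := hasSecondMoment_proj (μ : Measure 𝔼) (norm_sphere_le θ)
        have := hasSecondMoment_proj ν (norm_sphere_le θ)
        have hcont : Continuous fun x : 𝔼 => inner ℝ x (θ : 𝔼) := by fun_prop
        have : HasSecondMoment (μ.map hcont.aemeasurable : Measure ℝ) :=
          inferInstanceAs (HasSecondMoment (proj (μ : Measure 𝔼) θ))
        have hle := W2_le_liminf (ν := proj ν θ)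
          (μ := μ.map hcont.aemeasurable) (μs := fun n => (μs n).map hcont.aemeasurable)
          (ProbabilityMeasure.tendsto_map_of_tendsto_of_continuous μs μ h hcont)
        refine (pow_le_pow_left' hle 2).trans_eq ?_
        exact Monotone.map_liminf_of_continuousAt (f := fun a : ℝ≥0∞ => a ^ 2)
          (fun a b hab => pow_le_pow_left' hab 2) _ (ENNReal.continuous_pow 2).continuousAt
    _ ≤ liminf (fun n => ∫⁻ θ, W2 (proj (μs n : Measure 𝔼) θ) (proj ν θ) ^ 2 ∂sphereMeasure k)
          atTop := lintegral_liminf_le fun n => (measurable_W2_proj _ _).pow_const 2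
    _ ≤ c ^ 2 := by
        refine liminf_le_of_frequently_le' (hc.mono fun n hn => ?_).frequently
        rw [← SW2_sq]
        exact pow_le_pow_left' hn 2

/-- The sliced distance between the convolutions with a fixed measure `ρ`. -/
def SW2conv (ρ μ ν : Measure 𝔼) : ℝ≥0∞ := SW2 (μ.conv ρ) (ν.conv ρ)

lemma SW2conv_le_W2 (ρ μ ν : Measure 𝔼) [IsProbabilityMeasure ρ] : SW2conv ρ μ ν ≤ W2 μ ν :=
  (SW2_le_W2 _ _).trans (W2_conv_le _ _ _)

lemma eq_of_SW2conv_eq_zero {ρ μ ν : Measure 𝔼} [HasSecondMoment ρ] [HasSecondMoment μ]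
    [HasSecondMoment ν] (hρ : ∀ t, charFun ρ t ≠ 0) (h : SW2conv ρ μ ν = 0) : μ = ν := by
  refine Measure.ext_of_charFun (funext fun t => ?_)
  have := congrArg (fun m => charFun m t) (eq_of_SW2_eq_zero h)
  simp only [charFun_conv] at this
  exact mul_right_cancel₀ (hρ t) this

/-- Lower semicontinuity of the regularized sliced distance under weak convergence. -/
lemma SW2conv_le_of_tendsto (ρ : Measure 𝔼) [HasSecondMoment ρ] {μs : ℕ → ProbabilityMeasure 𝔼}
    {μ : ProbabilityMeasure 𝔼} {ν : Measure 𝔼} [hμs : ∀ n, HasSecondMoment (μs n : Measure 𝔼)]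
    [HasSecondMoment (μ : Measure 𝔼)] [HasSecondMoment ν] (h : Tendsto μs atTop (𝓝 μ))
    {c : ℝ≥0∞} (hc : ∀ᶠ n in atTop, SW2conv ρ (μs n : Measure 𝔼) ν ≤ c) :
    SW2conv ρ (μ : Measure 𝔼) ν ≤ c := by
  let conv : ProbabilityMeasure 𝔼 → ProbabilityMeasure 𝔼 := fun τ =>
    ⟨(τ : Measure 𝔼).conv ρ, inferInstance⟩
  have hconv : ∀ τ : ProbabilityMeasure 𝔼, (conv τ : Measure 𝔼) = (τ : Measure 𝔼).conv ρ :=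
    fun _ => rfl
  have hlim : Tendsto (fun n => conv (μs n)) atTop (𝓝 (conv μ)) := by
    rw [ProbabilityMeasure.tendsto_iff_tendsto_charFun] at h ⊢
    intro t
    simp only [hconv, charFun_conv]
    exact (h t).mul_const _
  have : HasSecondMoment (conv μ : Measure 𝔼) := hasSecondMoment_conv _ _
  have : ∀ n, HasSecondMoment (conv (μs n) : Measure 𝔼) := fun n => hasSecondMoment_conv _ _
  exact SW2_le_of_tendsto (μs := fun n => conv (μs n)) hlim hc

lemma exists_subseq_tendsto_of_SW2conv (ρ : Measure 𝔼) [HasSecondMoment ρ]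
    {μs : ℕ → ProbabilityMeasure 𝔼} {ν : Measure 𝔼}
    [∀ n, HasSecondMoment (μs n : Measure 𝔼)] [HasSecondMoment ν] {M : ℝ≥0∞} (hM : M ≠ ∞)
    (hμs : ∀ n, SW2conv ρ (μs n : Measure 𝔼) ν ≤ M) :
    ∃ (μ : ProbabilityMeasure 𝔼) (φ : ℕ → ℕ), StrictMono φ ∧
      Tendsto (μs ∘ φ) atTop (𝓝 μ) ∧ HasSecondMoment (μ : Measure 𝔼) := by
  obtain ⟨F, C, D, -, hle, hint⟩ := exists_moment_control ρ
  refine exists_subseq_tendsto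
    (M := C * (M + SW2 (ν.conv ρ) (Measure.dirac 0)) ^ 2 + D) ?_ fun n => ?_
  · have := SW2_ne_top (ν.conv ρ) (Measure.dirac 0)
    finiteness
  · calc ∫⁻ x, ‖x‖ₑ ^ 2 ∂(μs n : Measure 𝔼) ≤ ∫⁻ x, F x ∂(μs n : Measure 𝔼) :=
          lintegral_mono fun x => by
            rw [enorm_eq_nnnorm, ← ENNReal.coe_pow]
            exact ENNReal.coe_le_coe.2 (hle x)
      _ ≤ _ := by
          rw [hint _ inferInstance]
          gcongr
          exact (SW2_triangle _ (ν.conv ρ) _).trans (add_le_add (hμs n) le_rfl)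

theorem tendsto_W2_of_tendsto_SW2conv {ρ : Measure 𝔼} [HasSecondMoment ρ]
    (hρ : ∀ t, charFun ρ t ≠ 0) {μs : ℕ → Measure 𝔼} {μ : Measure 𝔼}
    [∀ n, HasSecondMoment (μs n)] [HasSecondMoment μ]
    (h : Tendsto (fun n => SW2conv ρ (μs n) μ) atTop (𝓝 0)) :
    Tendsto (fun n => W2 (μs n) μ) atTop (𝓝 0) := by
  obtain ⟨N, hN⟩ := eventually_atTop.1 (h.eventually_le_const zero_lt_one)
  refine tendsto_of_subseq_tendsto fun ns hns => ?_
  obtain ⟨N', hN'⟩ := eventually_atTop.1 (hns.eventually_ge_atTop N)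
  let τ : ℕ → ProbabilityMeasure 𝔼 := fun n => ⟨μs (ns (n + N')), inferInstance⟩
  have hτ : ∀ n, HasSecondMoment (τ n : Measure 𝔼) := fun n =>
    inferInstanceAs (HasSecondMoment (μs (ns (n + N'))))
  obtain ⟨μ', φ, hφ, hlim, hμ'⟩ := exists_subseq_tendsto_of_SW2conv ρ (μs := τ) (ν := μ)
    ENNReal.one_ne_top fun n => hN _ (hN' _ le_add_self)
  let ψ : ℕ → ℕ := fun n => φ n + N'
  have hns' : Tendsto (fun n => ns (ψ n)) atTop atTop :=
    hns.comp ((tendsto_add_atTop_nat N').comp hφ.tendsto_atTop)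
  have hS : Tendsto (fun n => SW2conv ρ (μs (ns (ψ n))) μ) atTop (𝓝 0) := h.comp hns'
  have heq : (μ' : Measure 𝔼) = μ := by
    refine eq_of_SW2conv_eq_zero hρ (nonpos_iff_eq_zero.1 (le_of_forall_gt_imp_ge_of_dense
      fun c hc => ?_))
    have : ∀ n, HasSecondMoment ((τ ∘ φ) n : Measure 𝔼) := fun n => hτ _
    exact SW2conv_le_of_tendsto ρ hlim (hS.eventually_le_const hc)
  have hφτ : ∀ n, HasSecondMoment ((τ ∘ φ) n : Measure 𝔼) := fun n => hτ _
  refine ⟨ψ, ?_⟩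
  obtain ⟨F, C, D, hF, hle, hint⟩ := exists_moment_control ρ
  have hW := tendsto_W2_of_tendsto_of_tendsto_lintegral hlim hF hle ?_ ?_
  · rw [heq] at hW
    exact hW
  · simp only [hint _ (inferInstance : IsProbabilityMeasure ((_ : ProbabilityMeasure 𝔼) : Measure 𝔼))]
    refine Tendsto.add (ENNReal.Tendsto.const_mul ?_ (Or.inr ENNReal.coe_ne_top)) tendsto_const_nhds
    refine ((ENNReal.continuous_pow 2).tendsto _).comp ?_
    rw [heq]
    have hne := SW2_ne_top (μ.conv ρ) (Measure.dirac 0)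
    refine tendsto_of_tendsto_of_tendsto_of_le_of_le
      (g := fun n => SW2 (μ.conv ρ) (Measure.dirac 0) - SW2conv ρ (μs (ns (ψ n))) μ)
      (h := fun n => SW2conv ρ (μs (ns (ψ n))) μ + SW2 (μ.conv ρ) (Measure.dirac 0)) ?_ ?_
      (fun n => ?_) fun n => ?_
    · have := ENNReal.Tendsto.sub (tendsto_const_nhds (x := SW2 (μ.conv ρ) (Measure.dirac 0)))
        hS (Or.inl hne)
      simpa using this
    · simpa using hS.add_const (SW2 (μ.conv ρ) (Measure.dirac 0))
    · refine tsub_le_iff_left.2 ?_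
      rw [SW2conv, SW2_comm _ (μ.conv ρ)]
      exact SW2_triangle _ _ _
    · exact SW2_triangle _ _ _
  · rw [hint _ inferInstance]
    have := SW2_ne_top ((μ' : Measure 𝔼).conv ρ) (Measure.dirac 0)
    finiteness

/-- A Cauchy sequence for the regularized sliced distance converges. -/
theorem exists_tendsto_SW2conv (ρ : Measure 𝔼) [HasSecondMoment ρ] {μs : ℕ → Measure 𝔼}
    [∀ n, HasSecondMoment (μs n)]
    (h : ∀ ε : ℝ≥0∞, 0 < ε → ∃ N, ∀ m ≥ N, ∀ n ≥ N, SW2conv ρ (μs m) (μs n) ≤ ε) :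
    ∃ μ : Measure 𝔼, HasSecondMoment μ ∧
      Tendsto (fun n => SW2conv ρ (μs n) μ) atTop (𝓝 0) := by
  obtain ⟨N, hN⟩ := h 1 zero_lt_one
  let τ : ℕ → ProbabilityMeasure 𝔼 := fun n => ⟨μs (n + N), inferInstance⟩
  have hτ : ∀ n, HasSecondMoment (τ n : Measure 𝔼) := fun n =>
    inferInstanceAs (HasSecondMoment (μs (n + N)))
  obtain ⟨μ, φ, hφ, hlim, hμ⟩ := exists_subseq_tendsto_of_SW2conv ρ (μs := τ) (ν := μs N)
    ENNReal.one_ne_top fun n => hN _ le_add_self _ le_rfl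
  refine ⟨μ, hμ, ENNReal.tendsto_nhds_zero.2 fun ε hε => ?_⟩
  obtain ⟨K, hK⟩ := h ε hε
  filter_upwards [eventually_ge_atTop K] with n hn
  rw [SW2conv, SW2_comm]
  have : ∀ n, HasSecondMoment ((τ ∘ φ) n : Measure 𝔼) := fun n => hτ _
  refine SW2conv_le_of_tendsto ρ hlim ?_
  filter_upwards [eventually_ge_atTop K] with m hm
  exact hK _ ((hm.trans (hφ.id_le m)).trans (Nat.le_add_right _ _)) _ hn

end Regularized

section MetricStructures

variable {k : ℕ} {σ : ℝ}

local notation "𝔼" => EuclideanSpace ℝ (Fin k)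

instance : IsGaussian (gaussianN k σ) := isGaussian_multivariateGaussian

instance : HasSecondMoment (gaussianN k σ) := ⟨IsGaussian.memLp_two_id.2.ne⟩

lemma charFun_gaussianN_ne_zero (t : 𝔼) : charFun (gaussianN k σ) t ≠ 0 := by
  rw [gaussianN, charFun_multivariateGaussian (Matrix.PosSemidef.one.smul (sq_nonneg σ))]
  exact Complex.exp_ne_zero _

instance (μ : P2 k) : HasSecondMoment μ.toMeasure := by
  have := μ.isProb
  refine .of_lintegral_ne_top ?_
  have h := μ.finite_moment.ne
  simpa only [ENNReal.ofReal_pow (norm_nonneg _), ofReal_norm] using h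

lemma P2.ext_measure {μ ν : P2 k} (h : μ.toMeasure = ν.toMeasure) : μ = ν := by
  cases μ
  cases ν
  congr

lemma exists_P2 (μ : Measure 𝔼) [HasSecondMoment μ] : ∃ ν : P2 k, ν.toMeasure = μ := by
  refine ⟨⟨μ, inferInstance, ?_⟩, rfl⟩
  simp only [ENNReal.ofReal_pow (norm_nonneg _), ofReal_norm]
  rw [show ∫⁻ x, ‖x‖ₑ ^ 2 ∂μ = eLpNorm id 2 μ ^ 2 from (eLpNorm_two_sq id μ).symm]
  exact (ENNReal.pow_ne_top HasSecondMoment.eLpNorm_id_ne_top).lt_top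

/-- The Wasserstein metric on `P2 k`. -/
abbrev wassersteinMetric (k : ℕ) : MetricSpace (P2 k) :=
  letI : EMetricSpace (P2 k) :=
    { edist := fun μ ν => W2 μ.toMeasure ν.toMeasure
      edist_self := fun μ => W2_self _
      edist_comm := fun μ ν => W2_comm _ _
      edist_triangle := fun μ ν τ => W2_triangle _ _ _
      eq_of_edist_eq_zero := fun h => P2.ext_measure (eq_of_W2_eq_zero h) }
  EMetricSpace.toMetricSpace fun μ ν => W2_ne_top μ.toMeasure ν.toMeasure

/-- The Gaussian-regularized sliced Wasserstein metric on `P2 k`. -/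
abbrev slicedMetric (k : ℕ) (σ : ℝ) : MetricSpace (P2 k) :=
  letI : EMetricSpace (P2 k) :=
    { edist := fun μ ν => SW2reg σ μ.toMeasure ν.toMeasure
      edist_self := fun μ => SW2_self _
      edist_comm := fun μ ν => SW2_comm _ _
      edist_triangle := fun μ ν τ => SW2_triangle _ _ _
      eq_of_edist_eq_zero := fun h =>
        P2.ext_measure (eq_of_SW2conv_eq_zero charFun_gaussianN_ne_zero h) }
  EMetricSpace.toMetricSpace fun μ ν => SW2_ne_top _ _

lemma edist_wassersteinMetric (μ ν : P2 k) :
    (wassersteinMetric k).edist μ ν = W2 μ.toMeasure ν.toMeasure := rfl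

lemma edist_slicedMetric (μ ν : P2 k) :
    (slicedMetric k σ).edist μ ν = SW2reg σ μ.toMeasure ν.toMeasure := rfl

lemma completeSpace_slicedMetric : @CompleteSpace (P2 k) (slicedMetric k σ).toUniformSpace := by
  let := slicedMetric k σ
  refine EMetric.complete_of_cauchySeq_tendsto fun u hu => ?_
  obtain ⟨μ, hμ, hlim⟩ := exists_tendsto_SW2conv (gaussianN k σ) (μs := fun n => (u n).toMeasure)
    fun ε hε => by
      obtain ⟨N, hN⟩ := EMetric.cauchySeq_iff.1 hu ε hε
      exact ⟨N, fun m hm n hn => (hN m hm n hn).le⟩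
  obtain ⟨ν, rfl⟩ := exists_P2 μ
  exact ⟨ν, tendsto_iff_edist_tendsto_0.2 hlim⟩

lemma topology_slicedMetric_eq :
    (slicedMetric k σ).toUniformSpace.toTopologicalSpace =
      (wassersteinMetric k).toUniformSpace.toTopologicalSpace := by
  refine le_antisymm ?_ ?_
  · rw [← continuous_id_iff_le]
    let := (slicedMetric k σ).toUniformSpace
    refine @SeqContinuous.continuous _ _ _ (_) _ _ fun u μ hu => ?_
    have hu' :=
      (@tendsto_iff_edist_tendsto_0 _ _ (slicedMetric k σ).toPseudoEMetricSpace _ _ _).1 hu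
    exact (@tendsto_iff_edist_tendsto_0 _ _ (wassersteinMetric k).toPseudoEMetricSpace _ _ _).2
      (tendsto_W2_of_tendsto_SW2conv charFun_gaussianN_ne_zero hu')
  · rw [← continuous_id_iff_le]
    refine @LipschitzWith.continuous _ _ (wassersteinMetric k).toPseudoEMetricSpace
      (slicedMetric k σ).toPseudoEMetricSpace 1 _ fun μ ν => ?_
    rw [ENNReal.coe_one, one_mul]
    exact SW2conv_le_W2 _ _ _

end MetricStructures

end

theorem lemma1 (k : ℕ) (σ : ℝ) (hσ : 0 ≤ σ) :
    ∃ mW mS : MetricSpace (P2 k),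
      (∀ μ ν : P2 k, mW.edist μ ν = W2 μ.toMeasure ν.toMeasure) ∧
      (∀ μ ν : P2 k, mS.edist μ ν = SW2reg σ μ.toMeasure ν.toMeasure) ∧
      @CompleteSpace (P2 k) mS.toUniformSpace ∧
      mS.toUniformSpace.toTopologicalSpace = mW.toUniformSpace.toTopologicalSpace :=
  ⟨wassersteinMetric k, slicedMetric k σ, edist_wassersteinMetric, edist_slicedMetric,
    completeSpace_slicedMetric, topology_slicedMetric_eq⟩
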